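/- Let $\chi$ be a probability distribution on $\{0,1,2,\dots\}$ with $\chi(0)<1$, let $G(x)=\sum_{m\ge 0}x^m\chi(m)$, $x\in[0,1]$, be its generating function (derivatives on $[0,1]$ are one-sided at the end points), and let $p_{-1},p_0,p_1\in[0,1]$ with $p_{-1}+p_0+p_1=1$. Let $T$ be the rooted Galton--Watson tree with offspring distribution $\chi$, whose edges carry independent weights equal to $k$ with probability $p_k$, $k\in\{-1,0,1\}$. Two players alternately move a token, initially at the root, from its current vertex to a child of it; whoever moves adds the weight of the traversed edge to her capital. Player 1 moves first; the initial capitals are $i$ (player 1) and $j$ (player 2). A player wins if her capital is the first to reach $\kappa=3$, or if her opponent's capital is the first to reach $0$, or, when neither of these has happened, if her opponent has to move from a leaf. The tree with its weights is known to both players. For $i,j\in\{1,2\}$ let $w_{i,j}$, $\ell_{i,j}$ and $d_{i,j}$ be the probabilities that player 1 can force a win, that player 2 can force a win, and that neither can (a draw). Let $\mathcal S$ be the set of $2\times2$ matrices with entries in $[0,1]$, let $f$ apply $G$ to every entry of a matrix, let $J$ be the all-ones $2\times 2$ matrix, $\mathbf 1=(1,1)^T$, $\mathbf e_1=(1,0)^T$,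 $P=\begin{pmatrix}p_0&p_1\\p_{-1}&p_0\end{pmatrix}$, and $$h(X)=f\left[p_{-1}\mathbf e_1\mathbf 1^T+P\left\{J-f\left(p_{-1}\mathbf 1\mathbf e_1^T+(J-X)P^T\right)\right\}\right],\qquad X\in\mathcal S.$$ Put $A_{1,1}=A_{1,2}=G(p_{-1})$, $B_{2,1}=B_{2,2}=G(1-p_1)$, $$A_{2,1}=G\big[p_{-1}\{1-G[1-(1-p_{-1})G(p_{-1})]\}\big],$$ $$\begin{aligned}A_{2,2}={}&G\big[p_{-1}\{1-G(1-G(p_{-1}))\}\big]+G\big[(1-p_1)\{1-G(1-p_1)\}\big]\\&-G\big[p_{-1}\{1-G(1-p_1)-G(1-G(p_{-1}))+G[(1-p_1)(1-G(p_{-1}))]\}\big],\end{aligned}$$ $$\begin{aligned}B_{1,1}={}&G[1-(1-p_{-1})G(p_{-1})]-G[(1-p_{-1})(1-G(p_{-1}))+p_{-1}]\\&+G\big[(1-p_{-1})(1-G(p_{-1}))+p_{-1}-p_1G\{1-G(1-p_1)\}+p_1G[p_{-1}(1-G(1-p_1))]\big],\end{aligned}$$ $$B_{1,2}=G\big[1-p_1G[(1-p_1)\{1-G(1-p_1)\}]\big].$$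 Define $f_1,f_2:[0,1]^2\to[0,1]$ by $f_1(x_1,x_2)=G(1-p_1x_2-p_0x_1)$ and $f_2(x_1,x_2)=G(p_0+p_{-1}-p_0x_2-p_{-1}x_1)$, and for $i,j\in\{1,2\}$ let $$\begin{aligned}E_{i,j}=\Big|\sum_{r=1}^{2}\partial_jf_r(A_{i,1},A_{i,2})\Big(&p_{i-1}\,G'\{1-p_1f_r(B_{2,1},B_{2,2})-p_0f_r(B_{1,1},B_{1,2})\}\\&+p_{i-2}\,G'\{p_0+p_{-1}-p_0f_r(B_{2,1},B_{2,2})-p_{-1}f_r(B_{1,1},B_{1,2})\}\Big)\Big|.\end{aligned}$$ Then, for all $i,j\in\{1,2\}$, $A_{i,j}\le\ell_{i,j}$ and $1-w_{i,j}\le B_{i,j}$. Moreover, if for all $i,j\in\{1,2\}$ the derivatives that occur in $E_{i,j}$ exist (are finite; this is automatic if $\chi$ has finite mean) and $E_{i,j}<1$, then $h$ has a unique fixed point in $\mathcal S$, and $d_{i,j}=0$ for all $i,j\in\{1,2\}$. -/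

import Mathlib

namespace CapitalGame

/-! ### Rooted edge-weighted trees (Ulam–Harris encoding)

A vertex is a finite word, the root is `[]`, and the children of `v` are the words `k :: v` with
`k` smaller than the number of children of `v`. -/

/-- A rooted edge-weighted tree: to every word `v` it attaches the number `(t v).1` of children of
`v` and the weight `(t v).2 ∈ {-1, 0, 1}` of the edge that joins the parent of `v` to `v`
(the second component is not used at the root, and neither component is used at words that are
not vertices). -/
abbrev WTree : Type := List ℕ → ℕ × SignType

/-- The number of children of the vertex `v`. -/
def WTree.numChildren (t : WTree) (v : List ℕ) : ℕ := (t v).1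

/-- The weight of the edge from the parent of `v` to `v`. -/
def WTree.weight (t : WTree) (v : List ℕ) : ℤ := ((t v).2 : ℤ)

/-! ### The game -/

/-- A position: the vertex that carries the token, the capital of the player whose turn it is
(`mine`), and the capital of her opponent (`theirs`). -/
structure Position where
  vertex : List ℕ
  mine : ℤ
  theirs : ℤ

/-- The position after the player whose turn it is has moved the token to the `k`-th child and has
received the weight of the edge. The roles of the two players are exchanged. -/
def move (t : WTree) (s : Position) (k : ℕ) : Position :=
  ⟨k :: s.vertex, s.theirs, s.mine + t.weight (k :: s.vertex)⟩

/-- The position is won for the player whose turn it is: her opponent has no capital left, or she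
has reached the target `κ`. -/
def MoverHasWon (κ : ℕ) (s : Position) : Prop :=
  s.theirs = 0 ∨ s.mine = κ

/-- The position is lost for the player whose turn it is: she has no capital left, or her opponent
has reached the target `κ`, or (the capitals being undecided) the token is at a leaf. -/
def MoverHasLost (t : WTree) (κ : ℕ) (s : Position) : Prop :=
  s.mine = 0 ∨ s.theirs = κ ∨ (¬ MoverHasWon κ s ∧ t.numChildren s.vertex = 0)

/-- The game is over at this position. -/
def Over (t : WTree) (κ : ℕ) (s : Position) : Prop :=
  MoverHasWon κ s ∨ MoverHasLost t κ s

/-- A strategy chooses a child at every vertex that has one. As the graph is a tree, the vertex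
determines the whole history of the game from its initial position. -/
def Strategy (t : WTree) : Type :=
  {σ : List ℕ → ℕ // ∀ v, 0 < t.numChildren v → σ v < t.numChildren v}

/-- The position after `n` rounds when the game starts at `s` and the first player uses `σ` and the
second player uses `τ` (positions after the end of the game are irrelevant). -/
def play (t : WTree) (σ τ : Strategy t) (s : Position) : ℕ → Position
  | 0 => s
  | n + 1 =>
    let r := play t σ τ s n
    if Even n then move t r (σ.1 r.vertex) else move t r (τ.1 r.vertex)

/-- With these strategies the game is over after exactly `n` rounds and the first player wins. -/
def FirstWinsAt (t : WTree) (κ : ℕ) (σ τ : Strategy t) (s : Position) (n : ℕ) : Prop :=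
  (∀ m < n, ¬ Over t κ (play t σ τ s m)) ∧
    if Even n then MoverHasWon κ (play t σ τ s n) else MoverHasLost t κ (play t σ τ s n)

/-- With these strategies the game is over after exactly `n` rounds and the second player wins. -/
def SecondWinsAt (t : WTree) (κ : ℕ) (σ τ : Strategy t) (s : Position) (n : ℕ) : Prop :=
  (∀ m < n, ¬ Over t κ (play t σ τ s m)) ∧
    if Even n then MoverHasLost t κ (play t σ τ s n) else MoverHasWon κ (play t σ τ s n)

/-- The first player wins the game with initial capitals `i`, `j`, target `κ` and initial vertex
`v`: she has a strategy that wins against all strategies of her opponent. -/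
def Wins (t : WTree) (κ : ℕ) (v : List ℕ) (i j : ℤ) : Prop :=
  ∃ σ : Strategy t, ∀ τ : Strategy t, ∃ n, FirstWinsAt t κ σ τ ⟨v, i, j⟩ n

/-- The first player loses: the second player has a strategy that wins against all strategies of
the first player. -/
def Loses (t : WTree) (κ : ℕ) (v : List ℕ) (i j : ℤ) : Prop :=
  ∃ τ : Strategy t, ∀ σ : Strategy t, ∃ n, SecondWinsAt t κ σ τ ⟨v, i, j⟩ n

/-- The game is a draw: neither player can force a win. -/
def Draws (t : WTree) (κ : ℕ) (v : List ℕ) (i j : ℤ) : Prop :=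
  ¬ Wins t κ v i j ∧ ¬ Loses t κ v i j

/-! ### The random tree and the outcome probabilities -/

instance instMeasurableSpaceSignType : MeasurableSpace SignType := ⊤

/-- The law of the Galton–Watson tree with offspring distribution `χ` and independent edge weights
of law `p`: all numbers of children and all edge weights are independent. -/
noncomputable def treeLaw (χ : PMF ℕ) (p : PMF SignType) : MeasureTheory.Measure WTree :=
  MeasureTheory.Measure.infinitePi fun _ : List ℕ => χ.toMeasure.prod p.toMeasure

/-- The probability `w i j` that the first player wins. -/
noncomputable def winProb (χ : PMF ℕ) (p : PMF SignType) (κ : ℕ) (i j : ℤ) : ℝ :=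
  (treeLaw χ p).real {t | Wins t κ [] i j}

/-- The probability `ℓ i j` that the first player loses. -/
noncomputable def lossProb (χ : PMF ℕ) (p : PMF SignType) (κ : ℕ) (i j : ℤ) : ℝ :=
  (treeLaw χ p).real {t | Loses t κ [] i j}

/-- The probability `d i j` of a draw. -/
noncomputable def drawProb (χ : PMF ℕ) (p : PMF SignType) (κ : ℕ) (i j : ℤ) : ℝ :=
  (treeLaw χ p).real {t | Draws t κ [] i j}

/-! ### The generating function and the fixed point map -/

/-- The probability generating function of `χ` (used on `[0, 1]` only). -/
noncomputable def pgf (χ : PMF ℕ) (x : ℝ) : ℝ := ∑' m : ℕ, x ^ m * (χ m).toReal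

/-- The derivative of the generating function as a function on `[0, 1]`, one-sided at the end
points. -/
noncomputable def pgf' (χ : PMF ℕ) (x : ℝ) : ℝ := derivWithin (pgf χ) (Set.Icc 0 1) x

/-- `p₋₁`. -/
noncomputable def pm (p : PMF SignType) : ℝ := (p (-1)).toReal

/-- `p₀`. -/
noncomputable def pz (p : PMF SignType) : ℝ := (p 0).toReal

/-- `p₁`. -/
noncomputable def pp (p : PMF SignType) : ℝ := (p 1).toReal

/-- The tridiagonal matrix `P`, here of size `n = κ - 1`. -/
noncomputable def stepMatrix (p : PMF SignType) (n : ℕ) : Matrix (Fin n) (Fin n) ℝ :=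
  Matrix.of fun i j =>
    if (j : ℕ) + 1 = i then pm p
    else if j = i then pz p
    else if (j : ℕ) = i + 1 then pp p
    else 0

/-- The column vector `e₁`. -/
def e1 (n : ℕ) : Fin n → ℝ := fun i => if (i : ℕ) = 0 then 1 else 0

/-- The matrices with entries in `[0, 1]`. -/
def unitMatrices (n : ℕ) : Set (Matrix (Fin n) (Fin n) ℝ) :=
  {X | ∀ i j, X i j ∈ Set.Icc (0 : ℝ) 1}

/-- The map `h(X) = f[p₋₁ e₁ 1ᵀ + P {J - f(p₋₁ 1 e₁ᵀ + (J - X) Pᵀ)}]`, where `f` applies the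
generating function to every entry and `J` is the all-ones matrix. -/
noncomputable def h (χ : PMF ℕ) (p : PMF SignType) (n : ℕ) (X : Matrix (Fin n) (Fin n) ℝ) :
    Matrix (Fin n) (Fin n) ℝ :=
  let P := stepMatrix p n
  let J : Matrix (Fin n) (Fin n) ℝ := Matrix.of fun _ _ => 1
  (pm p • Matrix.vecMulVec (e1 n) 1 +
    P * (J - (pm p • Matrix.vecMulVec 1 (e1 n) + (J - X) * P.transpose).map (pgf χ))).map (pgf χ)

/-! ### The explicit quantities for target capital `3`

The index `i : Fin 2` stands for `i + 1 ∈ {1, 2}`. -/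

/-- The matrix of the lower bounds `A`. -/
noncomputable def A (χ : PMF ℕ) (p : PMF SignType) : Matrix (Fin 2) (Fin 2) ℝ :=
  let G := pgf χ
  !![G (pm p), G (pm p);
     G (pm p * (1 - G (1 - (1 - pm p) * G (pm p)))),
     G (pm p * (1 - G (1 - G (pm p)))) + G ((1 - pp p) * (1 - G (1 - pp p)))
       - G (pm p * (1 - G (1 - pp p) - G (1 - G (pm p)) + G ((1 - pp p) * (1 - G (pm p)))))]

/-- The matrix of the upper bounds `B`. -/
noncomputable def B (χ : PMF ℕ) (p : PMF SignType) : Matrix (Fin 2) (Fin 2) ℝ :=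
  let G := pgf χ
  !![G (1 - (1 - pm p) * G (pm p)) - G ((1 - pm p) * (1 - G (pm p)) + pm p)
       + G ((1 - pm p) * (1 - G (pm p)) + pm p - pp p * G (1 - G (1 - pp p))
           + pp p * G (pm p * (1 - G (1 - pp p)))),
     G (1 - pp p * G ((1 - pp p) * (1 - G (1 - pp p))));
     G (1 - pp p), G (1 - pp p)]

/-- `f₁(x₁, x₂) = G(1 - p₁ x₂ - p₀ x₁)`. -/
noncomputable def f1 (χ : PMF ℕ) (p : PMF SignType) (x : Fin 2 → ℝ) : ℝ :=
  pgf χ (1 - pp p * x 1 - pz p * x 0)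

/-- `f₂(x₁, x₂) = G(p₀ + p₋₁ - p₀ x₂ - p₋₁ x₁)`. -/
noncomputable def f2 (χ : PMF ℕ) (p : PMF SignType) (x : Fin 2 → ℝ) : ℝ :=
  pgf χ (pz p + pm p - pz p * x 1 - pm p * x 0)

/-- The function `f` on `[0, 1]²`, as a function of its `j`-th variable. -/
noncomputable def slice (f : (Fin 2 → ℝ) → ℝ) (x : Fin 2 → ℝ) (j : Fin 2) (s : ℝ) : ℝ :=
  f (Function.update x j s)

/-- The `j`-th partial derivative at `x` of the function `f` on `[0, 1]²`. -/
noncomputable def pderiv (f : (Fin 2 → ℝ) → ℝ) (j : Fin 2) (x : Fin 2 → ℝ) : ℝ :=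
  derivWithin (slice f x j) (Set.Icc 0 1) (x j)

/-- `1 - p₁ f(B₂₁, B₂₂) - p₀ f(B₁₁, B₁₂)`. -/
noncomputable def outerU (χ : PMF ℕ) (p : PMF SignType) (f : (Fin 2 → ℝ) → ℝ) : ℝ :=
  1 - pp p * f (B χ p 1) - pz p * f (B χ p 0)

/-- `p₀ + p₋₁ - p₀ f(B₂₁, B₂₂) - p₋₁ f(B₁₁, B₁₂)`. -/
noncomputable def outerV (χ : PMF ℕ) (p : PMF SignType) (f : (Fin 2 → ℝ) → ℝ) : ℝ :=
  pz p + pm p - pz p * f (B χ p 1) - pm p * f (B χ p 0)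

/-- The quantity `E`; `![pz p, pp p] i` is `p_{i-1}` and `![pm p, pz p] i` is `p_{i-2}` for
`i ∈ {1, 2}`. -/
noncomputable def E (χ : PMF ℕ) (p : PMF SignType) (i j : Fin 2) : ℝ :=
  |![pz p, pp p] i * pderiv (f1 χ p) j (A χ p i) * pgf' χ (outerU χ p (f1 χ p))
    + ![pz p, pp p] i * pderiv (f2 χ p) j (A χ p i) * pgf' χ (outerU χ p (f2 χ p))
    + ![pm p, pz p] i * pderiv (f1 χ p) j (A χ p i) * pgf' χ (outerV χ p (f1 χ p))
    + ![pm p, pz p] i * pderiv (f2 χ p) j (A χ p i) * pgf' χ (outerV χ p (f2 χ p))|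

/-- The derivatives that occur in `E` exist as finite numbers. (They can only fail to exist where
the generating function is evaluated at `1` and `χ` has infinite mean.) -/
def EDefined (χ : PMF ℕ) (p : PMF SignType) (i j : Fin 2) : Prop :=
  ∀ f ∈ ({f1 χ p, f2 χ p} : Set ((Fin 2 → ℝ) → ℝ)),
    DifferentiableWithinAt ℝ (slice f (A χ p i) j) (Set.Icc 0 1) (A χ p i j) ∧
    DifferentiableWithinAt ℝ (pgf χ) (Set.Icc 0 1) (outerU χ p f) ∧
    DifferentiableWithinAt ℝ (pgf χ) (Set.Icc 0 1) (outerV χ p f)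

end CapitalGame

namespace CapitalGame

/-! ### Positions won or lost within a bounded number of moves -/

-- A forced win can be described without strategies. A position is won in bounded time if the mover
-- has won or some move leads to a position lost in bounded time, and it is lost in bounded time if
-- she has lost or every move leads to a position won in bounded time. As all vertex degrees are
-- finite, these notions agree with the existence of winning strategies (`wins_iff`, `loses_iff`).
--
-- In an undecided position at the root the mover loses iff the opponent wins at every child, and
-- she fails to win iff the opponent avoids a loss at every child. The label at the root of a
-- subtree carries the weight of the edge leading to it, so the subtrees, edge weights included, are
-- independent copies of the whole tree. Hence both probabilities are values of the generating
-- function at an average over one edge weight (`lossProb_eq`, `one_sub_winProb_eq`). With target 3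
-- this says that the matrix L of loss probabilities and the matrix U of probabilities not to win
-- are exchanged by a single map `halfStep`. The square of this map is `h`, so L and U are both
-- fixed points of `h`.
--
-- The map `halfStep` reverses the order. Feeding the trivial bounds 0 and 1 into it a few times,
-- and weakening some of the results by convexity of the generating function, gives
-- `bounds_of_halfStep`: any pair of matrices exchanged by `halfStep` lies between A and B. This
-- applies to (L, U), and also to (X, `halfStep` X) for an arbitrary fixed point X of `h`, so all
-- fixed points lie between A and B.
--
-- Between these bounds convexity controls each increment by a derivative at an extreme point: A for
-- the inner application of `halfStep`, B for the outer one. Summing the entries of |h(X) - h(Y)|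
-- gives at most the sum of E_ij |X_ij - Y_ij|. If every E_ij is less than 1, two fixed points must
-- coincide (`eq_of_halfStep_halfStep_eq`). Thus L = U, and the draw probabilities, which are the
-- entries of U - L, vanish.

mutual

/-- The player whose turn it is can force a win in fewer than `n` moves. -/
def WinsIn (t : WTree) (κ : ℕ) : ℕ → Position → Prop
  | 0, _ => False
  | n + 1, s => MoverHasWon κ s ∨
      (¬ Over t κ s ∧ ∃ k < t.numChildren s.vertex, LosesIn t κ n (move t s k))

/-- The opponent of the player whose turn it is can force a win in fewer than `n` moves. -/
def LosesIn (t : WTree) (κ : ℕ) : ℕ → Position → Prop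
  | 0, _ => False
  | n + 1, s => MoverHasLost t κ s ∨
      (¬ Over t κ s ∧ ∀ k < t.numChildren s.vertex, WinsIn t κ n (move t s k))

end

/-- The player whose turn it is can force a win in a bounded number of moves. -/
def MoverWins (t : WTree) (κ : ℕ) (s : Position) : Prop := ∃ n, WinsIn t κ n s

/-- The opponent of the player whose turn it is can force a win in a bounded number of moves. -/
def MoverLoses (t : WTree) (κ : ℕ) (s : Position) : Prop := ∃ n, LosesIn t κ n s

lemma winsIn_losesIn_succ (t : WTree) (κ n : ℕ) :
    ∀ s, (WinsIn t κ n s → WinsIn t κ (n + 1) s) ∧ (LosesIn t κ n s → LosesIn t κ (n + 1) s) := by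
  induction n with
  | zero => intro s; simp [WinsIn, LosesIn]
  | succ n ih =>
    intro s
    constructor
    · rintro (hs | ⟨hs, k, hk, hl⟩)
      · exact Or.inl hs
      · exact Or.inr ⟨hs, k, hk, (ih _).2 hl⟩
    · rintro (hs | ⟨hs, hw⟩)
      · exact Or.inl hs
      · exact Or.inr ⟨hs, fun k hk => (ih _).1 (hw k hk)⟩

lemma winsIn_mono (t : WTree) (κ : ℕ) (s : Position) {m n : ℕ} (hmn : m ≤ n)
    (hw : WinsIn t κ m s) : WinsIn t κ n s :=
  Nat.le_induction hw (fun n _ ih => (winsIn_losesIn_succ t κ n s).1 ih) n hmn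

lemma moverWins_iff (t : WTree) (κ : ℕ) (s : Position) :
    MoverWins t κ s ↔ MoverHasWon κ s ∨
      (¬ Over t κ s ∧ ∃ k < t.numChildren s.vertex, MoverLoses t κ (move t s k)) := by
  constructor
  · rintro ⟨_ | n, hn⟩
    · exact (hn : False).elim
    · rcases hn with hs | ⟨hs, k, hk, hl⟩
      · exact Or.inl hs
      · exact Or.inr ⟨hs, k, hk, n, hl⟩
  · rintro (hs | ⟨hs, k, hk, n, hl⟩)
    · exact ⟨1, Or.inl hs⟩
    · exact ⟨n + 1, Or.inr ⟨hs, k, hk, hl⟩⟩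

/-- The number of children is finite, so the bounds for the individual replies have a maximum. This
is where finite branching makes a bounded horizon sufficient. -/
lemma moverLoses_iff (t : WTree) (κ : ℕ) (s : Position) :
    MoverLoses t κ s ↔ MoverHasLost t κ s ∨
      (¬ Over t κ s ∧ ∀ k < t.numChildren s.vertex, MoverWins t κ (move t s k)) := by
  constructor
  · rintro ⟨_ | n, hn⟩
    · exact (hn : False).elim
    · rcases hn with hs | ⟨hs, hw⟩
      · exact Or.inl hs
      · exact Or.inr ⟨hs, fun k hk => ⟨n, hw k hk⟩⟩
  · rintro (hs | ⟨hs, hw⟩)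
    · exact ⟨1, Or.inl hs⟩
    · choose! n hn using hw
      refine ⟨(Finset.range (t.numChildren s.vertex)).sup n + 1, Or.inr ⟨hs, fun k hk => ?_⟩⟩
      exact winsIn_mono t κ _ (Finset.le_sup (f := n) (Finset.mem_range.2 hk)) (hn k hk)

/-! ### Strategies -/

/-- `play` recurses on the last round. Peeling off the first round instead exchanges the two
players, which is what lets the inductions below follow `WinsIn` and `LosesIn`. -/
lemma play_succ (t : WTree) (σ τ : Strategy t) (s : Position) (n : ℕ) :
    play t σ τ s (n + 1) = play t τ σ (move t s (σ.1 s.vertex)) n := by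
  induction n with
  | zero => simp [play]
  | succ n ih =>
    rw [play, ih]
    simp only [play, Nat.even_add_one]
    by_cases hn : Even n <;> simp [hn]

lemma firstWinsAt_succ (t : WTree) (κ : ℕ) (σ τ : Strategy t) (s : Position) (n : ℕ) :
    FirstWinsAt t κ σ τ s (n + 1) ↔
      ¬ Over t κ s ∧ SecondWinsAt t κ τ σ (move t s (σ.1 s.vertex)) n := by
  simp only [FirstWinsAt, SecondWinsAt, play_succ, Nat.forall_lt_succ_left, Nat.even_add_one,
    and_assoc, ite_not]
  rfl

lemma secondWinsAt_succ (t : WTree) (κ : ℕ) (σ τ : Strategy t) (s : Position) (n : ℕ) :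
    SecondWinsAt t κ σ τ s (n + 1) ↔
      ¬ Over t κ s ∧ FirstWinsAt t κ τ σ (move t s (σ.1 s.vertex)) n := by
  simp only [FirstWinsAt, SecondWinsAt, play_succ, Nat.forall_lt_succ_left, Nat.even_add_one,
    and_assoc, ite_not]
  rfl

lemma firstWinsAt_zero (t : WTree) (κ : ℕ) (σ τ : Strategy t) (s : Position) :
    FirstWinsAt t κ σ τ s 0 ↔ MoverHasWon κ s := by
  simp [FirstWinsAt, play]

lemma secondWinsAt_zero (t : WTree) (κ : ℕ) (σ τ : Strategy t) (s : Position) :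
    SecondWinsAt t κ σ τ s 0 ↔ MoverHasLost t κ s := by
  simp [SecondWinsAt, play]

/-- The position in which the vertex `u` is reached when the game starts at `s`. -/
def positionAt (t : WTree) (s : Position) : List ℕ → Position
  | [] => s
  | k :: u => if k :: u = s.vertex then s else move t (positionAt t s u) k

lemma positionAt_vertex (t : WTree) (s : Position) : positionAt t s s.vertex = s := by
  cases h : s.vertex <;> simp [positionAt, h]

/-- A strategy sees only the vertex, so the capitals have to be recovered from the path since `s`.
The length condition guarantees that a child of `r.vertex` is not the starting vertex, where the
recursion in `positionAt` stops. -/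
lemma positionAt_move (t : WTree) (s r : Position) (k : ℕ) (hr : positionAt t s r.vertex = r)
    (hl : s.vertex.length ≤ r.vertex.length) :
    positionAt t s (move t r k).vertex = move t r k := by
  have hne : k :: r.vertex ≠ s.vertex := fun he => by
    have := congrArg List.length he
    simp only [List.length_cons] at this
    omega
  change positionAt t s (k :: r.vertex) = _
  rw [positionAt, if_neg hne, hr]

open Classical in
/-- The strategy that, in the game started at `s`, moves according to a rule `R` whenever the rule
admits a move. -/
noncomputable def ruleStrategy (t : WTree) (s : Position) (R : Position → ℕ → Prop) : Strategy t :=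
  ⟨fun u => if hu : ∃ k < t.numChildren u, R (positionAt t s u) k then hu.choose else 0, by
    intro v hv
    dsimp only
    split_ifs with hu
    · exact hu.choose_spec.1
    · exact hv⟩

lemma ruleStrategy_spec (t : WTree) (s r : Position) (R : Position → ℕ → Prop)
    (hr : positionAt t s r.vertex = r) (h : ∃ k < t.numChildren r.vertex, R r k) :
    R r ((ruleStrategy t s R).1 r.vertex) := by
  have hu : ∃ k < t.numChildren r.vertex, R (positionAt t s r.vertex) k := by rwa [hr]
  have h2 := hu.choose_spec.2
  simp only [ruleStrategy, dif_pos hu]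
  exact (congrArg (fun q => R q _) hr).mp h2

/-- A move is fast if it leads to a position that is lost for the opponent in at most as many
moves as after any other move. -/
def FastMove (t : WTree) (κ : ℕ) (r : Position) (k : ℕ) : Prop :=
  ∀ n, (∃ k' < t.numChildren r.vertex, LosesIn t κ n (move t r k')) → LosesIn t κ n (move t r k)

lemma losesIn_mono (t : WTree) (κ : ℕ) (s : Position) {m n : ℕ} (hmn : m ≤ n)
    (hw : LosesIn t κ m s) : LosesIn t κ n s :=
  Nat.le_induction hw (fun n _ ih => (winsIn_losesIn_succ t κ n s).2 ih) n hmn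

lemma exists_fastMove (t : WTree) (κ : ℕ) (r : Position)
    (h : ∃ n, ∃ k < t.numChildren r.vertex, LosesIn t κ n (move t r k)) :
    ∃ k < t.numChildren r.vertex, FastMove t κ r k := by
  classical
  obtain ⟨k, hk, hl⟩ := Nat.find_spec h
  exact ⟨k, hk, fun n hn => losesIn_mono t κ _ (Nat.find_min' h hn) hl⟩

lemma numChildren_pos_of_not_over {t : WTree} {κ : ℕ} {s : Position} (hs : ¬ Over t κ s) :
    0 < t.numChildren s.vertex := by
  rw [Nat.pos_iff_ne_zero]
  intro h0
  exact hs (Or.inr (Or.inr (Or.inr ⟨fun hw => hs (Or.inl hw), h0⟩)))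

/-- Moving to just any lost position for the opponent could postpone the win forever. A fast move
respects every available bound on the remaining length, so the bound `n` drops in each round. -/
lemma fastMove_wins (t : WTree) (κ : ℕ) (s : Position) (n : ℕ) :
    ∀ r, positionAt t s r.vertex = r → s.vertex.length ≤ r.vertex.length →
      (WinsIn t κ n r → ∀ τ, ∃ m, FirstWinsAt t κ (ruleStrategy t s (FastMove t κ)) τ r m) ∧
      (LosesIn t κ n r → ∀ σ, ∃ m, SecondWinsAt t κ σ (ruleStrategy t s (FastMove t κ)) r m) := by
  induction n with
  | zero => intro r _ _; simp [WinsIn, LosesIn]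
  | succ n ih =>
    intro r hr hl
    have hmove (k : ℕ) := ih (move t r k) (positionAt_move t s r k hr hl)
      (hl.trans (by simp [move]))
    constructor
    · rintro (hs | ⟨hs, hk⟩) τ
      · exact ⟨0, (firstWinsAt_zero ..).2 hs⟩
      · have hfast := ruleStrategy_spec t s r _ hr (exists_fastMove t κ r ⟨n, hk⟩) n hk
        obtain ⟨m, hm⟩ := (hmove _).2 hfast τ
        exact ⟨m + 1, (firstWinsAt_succ ..).2 ⟨hs, hm⟩⟩
    · rintro (hs | ⟨hs, hk⟩) σ
      · exact ⟨0, (secondWinsAt_zero ..).2 hs⟩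
      · obtain ⟨m, hm⟩ := (hmove _).1 (hk _ (σ.2 _ (numChildren_pos_of_not_over hs))) σ
        exact ⟨m + 1, (secondWinsAt_succ ..).2 ⟨hs, hm⟩⟩

/-- A move is safe if it does not lead to a position that is won for the opponent. -/
def SafeMove (t : WTree) (κ : ℕ) (r : Position) (k : ℕ) : Prop :=
  ¬ MoverWins t κ (move t r k)

/-- From a position that is not won, every move leads to one that is not lost, and from there a safe
reply exists. The invariant holds forever, so the player who moves safely is never beaten. -/
lemma safeMove_prevents (t : WTree) (κ : ℕ) (s : Position) (m : ℕ) :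
    ∀ r, positionAt t s r.vertex = r → s.vertex.length ≤ r.vertex.length →
      (¬ MoverWins t κ r → ∀ σ, ¬ FirstWinsAt t κ σ (ruleStrategy t s (SafeMove t κ)) r m) ∧
      (¬ MoverLoses t κ r → ∀ τ, ¬ SecondWinsAt t κ (ruleStrategy t s (SafeMove t κ)) τ r m) := by
  induction m with
  | zero =>
    intro r _ _
    simp only [firstWinsAt_zero, secondWinsAt_zero]
    exact ⟨fun hr _ hw => hr ((moverWins_iff ..).2 (Or.inl hw)),
      fun hr _ hw => hr ((moverLoses_iff ..).2 (Or.inl hw))⟩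
  | succ m ih =>
    intro r hr hl
    have hmove (k : ℕ) := ih (move t r k) (positionAt_move t s r k hr hl)
      (hl.trans (by simp [move]))
    simp only [firstWinsAt_succ, secondWinsAt_succ]
    constructor
    · rintro hw σ ⟨hs, hσ⟩
      refine (hmove _).2 (fun hlose => hw ((moverWins_iff ..).2 (Or.inr ⟨hs, _, ?_, hlose⟩))) σ hσ
      exact σ.2 _ (numChildren_pos_of_not_over hs)
    · rintro hw τ ⟨hs, hτ⟩
      refine (hmove _).1 (ruleStrategy_spec t s r (SafeMove t κ) hr ?_) τ hτ
      by_contra! hk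
      exact hw ((moverLoses_iff ..).2 (Or.inr ⟨hs, fun k hk' => not_not.1 (hk k hk')⟩))

theorem wins_iff (t : WTree) (κ : ℕ) (v : List ℕ) (i j : ℤ) :
    Wins t κ v i j ↔ MoverWins t κ ⟨v, i, j⟩ := by
  constructor
  · rintro ⟨σ, hσ⟩
    by_contra hw
    obtain ⟨m, hm⟩ := hσ (ruleStrategy t ⟨v, i, j⟩ (SafeMove t κ))
    exact (safeMove_prevents t κ _ m _ (positionAt_vertex t _) le_rfl).1 hw σ hm
  · rintro ⟨n, hn⟩
    exact ⟨_, (fastMove_wins t κ _ n _ (positionAt_vertex t _) le_rfl).1 hn⟩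

theorem loses_iff (t : WTree) (κ : ℕ) (v : List ℕ) (i j : ℤ) :
    Loses t κ v i j ↔ MoverLoses t κ ⟨v, i, j⟩ := by
  constructor
  · rintro ⟨σ, hσ⟩
    by_contra hw
    obtain ⟨m, hm⟩ := hσ (ruleStrategy t ⟨v, i, j⟩ (SafeMove t κ))
    exact (safeMove_prevents t κ _ m _ (positionAt_vertex t _) le_rfl).2 hw σ hm
  · rintro ⟨n, hn⟩
    exact ⟨_, (fastMove_wins t κ _ n _ (positionAt_vertex t _) le_rfl).2 hn⟩

/-! ### Subtrees -/

/-- The subtree that descends from the `k`-th child of the root. -/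
def WTree.subtree (t : WTree) (k : ℕ) : WTree := fun u => t (u ++ [k])

lemma winsIn_losesIn_subtree (t : WTree) (κ k : ℕ) (n : ℕ) : ∀ u a b,
    (WinsIn t κ n ⟨u ++ [k], a, b⟩ ↔ WinsIn (t.subtree k) κ n ⟨u, a, b⟩) ∧
    (LosesIn t κ n ⟨u ++ [k], a, b⟩ ↔ LosesIn (t.subtree k) κ n ⟨u, a, b⟩) := by
  induction n with
  | zero => intro u a b; simp [WinsIn, LosesIn]
  | succ n ih =>
    intro u a b
    have hw (l : ℕ) := ih (l :: u)
    simp only [List.cons_append] at hw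
    simp only [WinsIn, LosesIn, MoverHasWon, MoverHasLost, Over, move, WTree.numChildren,
      WTree.weight, hw, WTree.subtree, List.cons_append, and_self]

lemma moverWins_subtree (t : WTree) (κ k : ℕ) (a b : ℤ) :
    MoverWins t κ ⟨[k], a, b⟩ ↔ MoverWins (t.subtree k) κ ⟨[], a, b⟩ :=
  exists_congr fun n => (winsIn_losesIn_subtree t κ k n [] a b).1

lemma moverLoses_subtree (t : WTree) (κ k : ℕ) (a b : ℤ) :
    MoverLoses t κ ⟨[k], a, b⟩ ↔ MoverLoses (t.subtree k) κ ⟨[], a, b⟩ :=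
  exists_congr fun n => (winsIn_losesIn_subtree t κ k n [] a b).2

/-- The capitals `a` and `b` do not decide the game with target `κ`. -/
def Undecided (κ : ℕ) (a b : ℤ) : Prop := (a ≠ 0 ∧ a ≠ κ) ∧ b ≠ 0 ∧ b ≠ κ

/-- The leaf rule needs no separate case: the quantifier over the children is then vacuous. The edge
weight is read off as the root label of the subtree, so the condition is one and the same event for
each subtree. -/
lemma moverLoses_root_iff (t : WTree) (κ : ℕ) (a b : ℤ) (hab : Undecided κ a b) :
    MoverLoses t κ ⟨[], a, b⟩ ↔ ∀ k < (t []).1,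
      MoverWins (t.subtree k) κ ⟨[], b, a + ((t.subtree k []).2 : ℤ)⟩ := by
  obtain ⟨⟨ha, ha'⟩, hb, hb'⟩ := hab
  rw [moverLoses_iff]
  simp only [← moverWins_subtree, Over, MoverHasLost, MoverHasWon, ha, ha', hb, hb',
    WTree.numChildren, move, WTree.weight, WTree.subtree, List.nil_append, false_or,
    not_false_eq_true, true_and]
  refine ⟨?_, fun H => ?_⟩
  · rintro (h0 | ⟨-, h1⟩)
    · simp [h0]
    · exact h1
  · by_cases h0 : (t []).1 = 0
    · exact Or.inl h0
    · exact Or.inr ⟨h0, H⟩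

lemma not_moverWins_root_iff (t : WTree) (κ : ℕ) (a b : ℤ) (hab : Undecided κ a b) :
    ¬ MoverWins t κ ⟨[], a, b⟩ ↔ ∀ k < (t []).1,
      ¬ MoverLoses (t.subtree k) κ ⟨[], b, a + ((t.subtree k []).2 : ℤ)⟩ := by
  obtain ⟨⟨ha, ha'⟩, hb, hb'⟩ := hab
  rw [moverWins_iff]
  simp only [← moverLoses_subtree, Over, MoverHasLost, MoverHasWon, ha, ha', hb, hb',
    WTree.numChildren, move, WTree.weight, WTree.subtree, List.nil_append, false_or,
    not_false_eq_true, true_and]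
  push Not
  refine ⟨fun H k hk => H (by omega) k hk, fun H _ => H⟩

open MeasureTheory ProbabilityTheory

/-! ### The branching property of the random tree -/

section Branching

variable (χ : PMF ℕ) (p : PMF SignType)

instance isProbabilityMeasure_treeLaw : IsProbabilityMeasure (treeLaw χ p) := by
  unfold treeLaw; infer_instance

lemma measurable_subtree (k : ℕ) : Measurable fun t : WTree => t.subtree k := by
  unfold WTree.subtree; fun_prop

/-- The words ending in different letters form disjoint families of coordinates, each a copy of the
full index set; a product measure therefore restricts to independent copies of itself. -/
lemma map_subtree_treeLaw :
    (treeLaw χ p).map (fun t k => t.subtree k) = Measure.infinitePi fun _ : ℕ => treeLaw χ p := by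
  have hinj : Function.Injective fun q : ℕ × List ℕ => q.2 ++ [q.1] := by
    rintro ⟨k, u⟩ ⟨k', u'⟩ he
    obtain ⟨h1, h2⟩ := List.append_inj' he rfl
    simp_all
  have h1 := Measure.map_infinitePi_infinitePi_of_inj
    (P := fun _ : List ℕ => χ.toMeasure.prod p.toMeasure) hinj
  have h2 := Measure.infinitePi_map_curry (ι := ℕ) (κ := List ℕ)
    (fun _ _ => χ.toMeasure.prod p.toMeasure)
  rw [← h1, Measure.map_map (by fun_prop) (by fun_prop)] at h2
  exact h2

lemma indepFun_root_subtree :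
    IndepFun (fun t : WTree => t []) (fun t k => t.subtree k) (treeLaw χ p) := by
  have hi : iIndepFun (fun (u : List ℕ) (t : WTree) => t u) (treeLaw χ p) :=
    iIndepFun_infinitePi (X := fun _ x => x) fun _ => measurable_id
  have h := indep_iSup_of_disjoint (fun u => (measurable_pi_apply u).comap_le) hi
    (S := {[]}) (T := {[]}ᶜ) disjoint_compl_right
  refine indep_of_indep_of_le_right (indep_of_indep_of_le_left h ?_) ?_
  · simp
  · simp only [MeasurableSpace.pi, MeasurableSpace.comap_iSup, MeasurableSpace.comap_comp]
    exact iSup_le fun k => iSup_le fun u =>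
      le_iSup₂_of_le (f := fun (i : List ℕ) (_ : i ∈ ({[]}ᶜ : Set (List ℕ))) =>
        MeasurableSpace.comap (fun t : WTree => t i) inferInstance) (u ++ [k]) (by simp) le_rfl

lemma treeLaw_root (m : ℕ) (e : SignType) :
    treeLaw χ p {t | t [] = (m, e)} = χ m * p e := by
  have h : (treeLaw χ p).map (fun t => t []) = χ.toMeasure.prod p.toMeasure :=
    Measure.infinitePi_map_eval _ []
  have h' := DFunLike.congr_fun h {(m, e)}
  rw [Measure.map_apply (by fun_prop) (measurableSet_singleton _), ← Set.singleton_prod_singleton,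
    Measure.prod_prod, PMF.toMeasure_apply_singleton _ _ (measurableSet_singleton _),
    PMF.toMeasure_apply_singleton _ _ (measurableSet_singleton _)] at h'
  rw [← h']
  congr 1
  ext t
  simp [Prod.ext_iff]

lemma treeLaw_forall_subtree {S : Set WTree} (hS : MeasurableSet S) (m : ℕ) :
    treeLaw χ p {t | ∀ k < m, t.subtree k ∈ S} = treeLaw χ p S ^ m := by
  have h := DFunLike.congr_fun (map_subtree_treeLaw χ p)
    ((Finset.range m : Set ℕ).pi fun _ => S)
  rw [Measure.infinitePi_pi _ (fun _ _ => hS), Measure.map_apply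
    (measurable_pi_lambda _ measurable_subtree)
    (.pi (Finset.countable_toSet _) fun _ _ => hS)] at h
  simp only [Finset.prod_const, Finset.card_range] at h
  rw [← h]
  congr 1
  ext t
  simp

lemma measurableSet_root_subtree {S : Set WTree} (hS : MeasurableSet S) (e : SignType) :
    MeasurableSet {t : WTree | (t []).2 = e ∧ ∀ k < (t []).1, t.subtree k ∈ S} := by
  have h : {t : WTree | (t []).2 = e ∧ ∀ k < (t []).1, t.subtree k ∈ S} =
      ⋃ m : ℕ, {t | t [] = (m, e)} ∩ ⋂ k ∈ Set.Iio m, {t | t.subtree k ∈ S} := by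
    ext t
    simp only [Set.mem_ofPred_eq, Set.mem_iUnion, Set.mem_inter_iff, Set.mem_iInter, Set.mem_Iio,
      Prod.ext_iff]
    constructor
    · rintro ⟨h1, h2⟩
      exact ⟨_, ⟨rfl, h1⟩, h2⟩
    · rintro ⟨m, ⟨rfl, h1⟩, h2⟩
      exact ⟨h1, h2⟩
  rw [h]
  refine .iUnion fun m => .inter ?_ (.biInter (Set.to_countable _) fun k _ => ?_)
  · exact (measurable_pi_apply []) (measurableSet_singleton _)
  · exact measurable_subtree k hS

/-- The weight at the root has law `p`, and it is independent of the event that all the subtrees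
descending from children of the root lie in `S`; the probability of this event is the value of the
generating function at the probability of `S`. -/
theorem treeLaw_root_subtree {S : Set WTree} (hS : MeasurableSet S) (e : SignType) :
    (treeLaw χ p).real {t | (t []).2 = e ∧ ∀ k < (t []).1, t.subtree k ∈ S} =
      (p e).toReal * pgf χ ((treeLaw χ p).real S) := by
  have hunion : {t : WTree | (t []).2 = e ∧ ∀ k < (t []).1, t.subtree k ∈ S} =
      ⋃ m : ℕ, {t | t [] = (m, e)} ∩ {t | ∀ k < m, t.subtree k ∈ S} := by
    ext t
    simp only [Set.mem_ofPred_eq, Set.mem_iUnion, Set.mem_inter_iff, Prod.ext_iff]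
    constructor
    · rintro ⟨h1, h2⟩
      exact ⟨_, ⟨rfl, h1⟩, h2⟩
    · rintro ⟨m, ⟨rfl, h1⟩, h2⟩
      exact ⟨h1, h2⟩
  have hmS (m : ℕ) : MeasurableSet {t : WTree | ∀ k < m, t.subtree k ∈ S} := by
    have : {t : WTree | ∀ k < m, t.subtree k ∈ S} = ⋂ k ∈ Set.Iio m, {t | t.subtree k ∈ S} := by
      ext; simp
    rw [this]
    exact .biInter (Set.to_countable _) fun k _ => measurable_subtree k hS
  have hroot (m : ℕ) : MeasurableSet {t : WTree | t [] = (m, e)} :=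
    (measurable_pi_apply []) (measurableSet_singleton _)
  have hind (m : ℕ) : treeLaw χ p ({t | t [] = (m, e)} ∩ {t | ∀ k < m, t.subtree k ∈ S}) =
      p e * (treeLaw χ p S ^ m * χ m) := by
    have h := (indepFun_root_subtree χ p).measure_inter_preimage_eq_mul {(m, e)}
      ((Finset.range m : Set ℕ).pi fun _ => S) (measurableSet_singleton _)
      (.pi (Finset.countable_toSet _) fun _ _ => hS)
    have h1 : (fun t : WTree => t []) ⁻¹' {(m, e)} = {t | t [] = (m, e)} := rfl
    have h2 : (fun (t : WTree) k => t.subtree k) ⁻¹' ((Finset.range m : Set ℕ).pi fun _ => S) =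
        {t | ∀ k < m, t.subtree k ∈ S} := by ext; simp
    rw [h1, h2, treeLaw_root, treeLaw_forall_subtree χ p hS] at h
    rw [h]
    ring
  rw [measureReal_def, hunion, measure_iUnion]
  · simp_rw [hind, ENNReal.tsum_mul_left, ENNReal.toReal_mul]
    rw [ENNReal.tsum_toReal_eq, pgf]
    · simp [measureReal_def]
    · intro m
      exact ENNReal.mul_ne_top (ENNReal.pow_ne_top (measure_ne_top _ _)) (PMF.apply_ne_top _ _)
  · intro m m' hm
    refine Set.disjoint_left.2 fun t ht ht' => hm ?_
    have := ht.1.symm.trans ht'.1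
    exact congrArg Prod.fst this
  · exact fun m => (hroot m).inter (hmS m)

lemma measureReal_eq_sum_root_weight {Q : SignType → Set WTree}
    (hQ : ∀ e, MeasurableSet {t | (t []).2 = e ∧ t ∈ Q e}) :
    (treeLaw χ p).real {t | t ∈ Q (t []).2} =
      ∑ e : SignType, (treeLaw χ p).real {t | (t []).2 = e ∧ t ∈ Q e} := by
  have h : {t : WTree | t ∈ Q (t []).2} =
      ⋃ e ∈ (Finset.univ : Finset SignType), {t | (t []).2 = e ∧ t ∈ Q e} := by
    ext t; simp
  rw [h, measureReal_biUnion_finset _ fun e _ => hQ e]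
  intro e _ e' _ he
  exact Set.disjoint_left.2 fun t ht ht' => he (ht.1.symm.trans ht'.1)

lemma sum_toReal_pmf_signType : pm p + pz p + pp p = 1 := by
  have h := congrArg ENNReal.toReal p.tsum_coe
  rw [tsum_fintype, ENNReal.toReal_sum fun _ _ => PMF.apply_ne_top _ _, ENNReal.toReal_one] at h
  rw [← h, show (Finset.univ : Finset SignType) = {-1, 0, 1} from by decide]
  simp [pm, pz, pp, add_assoc]

end Branching

/-! ### Recursion for the outcome probabilities -/

lemma measurableSet_numChildren (v : List ℕ) (s : Set ℕ) :
    MeasurableSet {t : WTree | t.numChildren v ∈ s} :=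
  (measurable_fst.comp (measurable_pi_apply v)) (MeasurableSet.of_discrete (s := s))

lemma measurableSet_move {Q : WTree → Position → Prop} (hQ : ∀ s, MeasurableSet {t | Q t s})
    (s : Position) (k : ℕ) : MeasurableSet {t | Q t (move t s k)} := by
  have h : {t | Q t (move t s k)} = ⋃ e : SignType,
      {t | (t (k :: s.vertex)).2 = e} ∩ {t | Q t ⟨k :: s.vertex, s.theirs, s.mine + (e : ℤ)⟩} := by
    ext t
    simp [move, WTree.weight]
  rw [h]
  exact .iUnion fun e => .inter
    ((measurable_snd.comp (measurable_pi_apply _)) (measurableSet_singleton e)) (hQ _)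

lemma measurable_moverHasLost (κ : ℕ) (s : Position) :
    Measurable fun t => MoverHasLost t κ s := by
  have h := measurableSet_setOfPred.1 (measurableSet_numChildren s.vertex {0})
  simp only [Set.mem_singleton_iff] at h
  unfold MoverHasLost
  exact .or measurable_const (.or measurable_const (.and measurable_const h))

lemma measurable_over (κ : ℕ) (s : Position) : Measurable fun t => Over t κ s :=
  .or measurable_const (measurable_moverHasLost κ s)

lemma measurableSet_winsIn_losesIn (κ n : ℕ) : ∀ s,
    MeasurableSet {t | WinsIn t κ n s} ∧ MeasurableSet {t | LosesIn t κ n s} := by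
  induction n with
  | zero => intro s; simp [WinsIn, LosesIn]
  | succ n ih =>
    intro s
    simp only [WinsIn, LosesIn, measurableSet_setOfPred]
    have hk (k : ℕ) := measurableSet_setOfPred.1 (measurableSet_numChildren s.vertex (Set.Ioi k))
    constructor
    · exact .or measurable_const (.and (measurable_over κ s).not (.exists fun k => .and (hk k)
        (measurableSet_setOfPred.1 (measurableSet_move (fun s => (ih s).2) s k))))
    · exact .or (measurable_moverHasLost κ s) (.and (measurable_over κ s).not (.forall fun k =>
        .imp (hk k) (measurableSet_setOfPred.1 (measurableSet_move (fun s => (ih s).1) s k))))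

lemma measurableSet_moverWins (κ : ℕ) (s : Position) : MeasurableSet {t | MoverWins t κ s} :=
  measurableSet_setOfPred.2
    (.exists fun n => measurableSet_setOfPred.1 (measurableSet_winsIn_losesIn κ n s).1)

lemma measurableSet_moverLoses (κ : ℕ) (s : Position) : MeasurableSet {t | MoverLoses t κ s} :=
  measurableSet_setOfPred.2
    (.exists fun n => measurableSet_setOfPred.1 (measurableSet_winsIn_losesIn κ n s).2)

/-- Without the condition on `s.mine` the two outcomes can overlap, for instance when both capitals
are 0. The condition passes to the next position, whose mover holds the old `s.theirs`, a capital
that is neither 0 nor `κ` while the game is not over. -/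
lemma not_winsIn_losesIn_and (t : WTree) (κ : ℕ) (hκ : κ ≠ 0) (n : ℕ) : ∀ s : Position,
    s.mine ≠ 0 → s.mine ≠ κ → ¬ (WinsIn t κ n s ∧ MoverLoses t κ s) ∧
      ¬ (LosesIn t κ n s ∧ MoverWins t κ s) := by
  induction n with
  | zero => intro s _ _; simp [WinsIn, LosesIn]
  | succ n ih =>
    intro s h0 h1
    have hdis : ¬ (MoverHasWon κ s ∧ MoverHasLost t κ s) := by
      rintro ⟨hw, hl | hl | hl⟩
      · exact h0 hl
      · rcases hw with hw | hw
        · exact hκ (by exact_mod_cast hl.symm.trans hw)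
        · exact h1 hw
      · exact hl.1 hw
    have hmove (hs : ¬ Over t κ s) (k : ℕ) := ih (move t s k)
      (fun he => hs (Or.inl (Or.inl he))) (fun he => hs (Or.inr (Or.inr (Or.inl he))))
    rw [moverLoses_iff, moverWins_iff]
    simp only [WinsIn, LosesIn]
    constructor
    · rintro ⟨hw | ⟨hs, k, hk, hl⟩, hl' | ⟨hs', hw'⟩⟩
      · exact hdis ⟨hw, hl'⟩
      · exact hs' (Or.inl hw)
      · exact hs (Or.inr hl')
      · exact (hmove hs k).2 ⟨hl, hw' k hk⟩
    · rintro ⟨hl | ⟨hs, hw⟩, hw' | ⟨hs', k, hk, hl'⟩⟩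
      · exact hdis ⟨hw', hl⟩
      · exact hs' (Or.inr hl)
      · exact hs (Or.inl hw')
      · exact (hmove hs k).1 ⟨hw k hk, hl'⟩

lemma not_moverWins_and_moverLoses (t : WTree) (κ : ℕ) (hκ : κ ≠ 0) (s : Position)
    (h0 : s.mine ≠ 0) (h1 : s.mine ≠ κ) : ¬ (MoverWins t κ s ∧ MoverLoses t κ s) :=
  fun ⟨⟨n, hn⟩, hl⟩ => (not_winsIn_losesIn_and t κ hκ n s h0 h1).1 ⟨hn, hl⟩

section Recursion

variable (χ : PMF ℕ) (p : PMF SignType)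

lemma pgf_one : pgf χ 1 = 1 := by
  have h := congrArg ENNReal.toReal χ.tsum_coe
  rw [ENNReal.tsum_toReal_eq fun _ => PMF.apply_ne_top _ _, ENNReal.toReal_one] at h
  simpa [pgf] using h

lemma sum_signType (f : SignType → ℝ) : ∑ e, f e = f (-1) + f 0 + f 1 := by
  rw [show (Finset.univ : Finset SignType) = {-1, 0, 1} by decide]
  simp [add_assoc]

/-- The event `C` is measurable and independent of the weight at the root. -/
structure RootIndep (C : Set WTree) : Prop where
  measurableSet : MeasurableSet C
  real_inter : ∀ e, (treeLaw χ p).real {t | (t []).2 = e ∧ t ∈ C} =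
    (p e).toReal * (treeLaw χ p).real C

lemma measurableSet_root_weight (e : SignType) : MeasurableSet {t : WTree | (t []).2 = e} :=
  (measurable_snd.comp (measurable_pi_apply _)) (measurableSet_singleton e)

variable {χ p}

lemma RootIndep.measurableSet_inter {C : Set WTree} (hC : RootIndep χ p C) (e : SignType) :
    MeasurableSet {t | (t []).2 = e ∧ t ∈ C} :=
  (measurableSet_root_weight e).inter hC.measurableSet

lemma real_eq_sum {Q : SignType → Set WTree} (hQ : ∀ e, RootIndep χ p (Q e)) :
    (treeLaw χ p).real {t | t ∈ Q (t []).2} =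
      pm p * (treeLaw χ p).real (Q (-1)) + pz p * (treeLaw χ p).real (Q 0) +
        pp p * (treeLaw χ p).real (Q 1) := by
  rw [measureReal_eq_sum_root_weight χ p fun e => (hQ e).measurableSet_inter e]
  simp only [(hQ _).real_inter, sum_signType, pm, pz, pp]

lemma measurableSet_mem_root_weight {Q : SignType → Set WTree} (hQ : ∀ e, MeasurableSet (Q e)) :
    MeasurableSet {t : WTree | t ∈ Q (t []).2} := by
  have h : {t : WTree | t ∈ Q (t []).2} = ⋃ e, {t | (t []).2 = e} ∩ Q e := by
    ext t; simp
  rw [h]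
  exact .iUnion fun e => (measurableSet_root_weight e).inter (hQ e)

variable (χ p) in
-- An event about the subtrees of the children ignores the root weight. This independence is needed
-- because, one level up, the same root weight is the edge that shifts the capital.
lemma rootIndep_forall_subtree {S : Set WTree} (hS : MeasurableSet S) :
    RootIndep χ p {t | ∀ k < (t []).1, t.subtree k ∈ S} ∧
      (treeLaw χ p).real {t | ∀ k < (t []).1, t.subtree k ∈ S} =
        pgf χ ((treeLaw χ p).real S) := by
  set C : Set WTree := {t | ∀ k < (t []).1, t.subtree k ∈ S} with hC
  have hreal : (treeLaw χ p).real C = pgf χ ((treeLaw χ p).real S) := by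
    have h := measureReal_eq_sum_root_weight χ p (Q := fun _ => C)
      (fun e => measurableSet_root_subtree hS e)
    simp only [hC, Set.mem_ofPred_eq, treeLaw_root_subtree χ p hS, sum_signType] at h
    rw [hC, h]
    have := sum_toReal_pmf_signType p
    simp only [pm, pz, pp] at this
    rw [← add_mul, ← add_mul, this, one_mul]
  refine ⟨⟨?_, fun e => ?_⟩, hreal⟩
  · have h : C = ⋃ e, {t | (t []).2 = e ∧ ∀ k < (t []).1, t.subtree k ∈ S} := by
      ext t; simp [hC]
    rw [h]
    exact .iUnion fun e => measurableSet_root_subtree hS e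
  · rw [hreal]
    exact treeLaw_root_subtree χ p hS e

variable (χ p) in
lemma rootIndep_univ : RootIndep χ p Set.univ := by
  simpa using (rootIndep_forall_subtree χ p MeasurableSet.univ).1

lemma RootIndep.compl {C : Set WTree} (hC : RootIndep χ p C) : RootIndep χ p Cᶜ := by
  refine ⟨hC.measurableSet.compl, fun e => ?_⟩
  have h := (rootIndep_univ χ p).real_inter e
  simp only [Set.mem_univ, and_true, probReal_univ, mul_one] at h
  have hdiff : {t : WTree | (t []).2 = e ∧ t ∈ Cᶜ} =
      {t | (t []).2 = e} \ {t | (t []).2 = e ∧ t ∈ C} := by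
    ext t
    simp only [Set.mem_ofPred_eq, Set.mem_sdiff, Set.mem_compl_iff]
    tauto
  rw [hdiff, measureReal_sdiff (s₁ := {t : WTree | (t []).2 = e}) (fun t ht => ht.1) (hC.measurableSet_inter e), h, hC.real_inter,
    probReal_compl_eq_one_sub hC.measurableSet]
  ring

variable (χ p) in
lemma rootIndep_empty : RootIndep χ p ∅ := by
  simpa using (rootIndep_univ χ p).compl

variable (χ p)

lemma measurableSet_moverWins_root_weight (κ : ℕ) (a b : ℤ) :
    MeasurableSet {t : WTree | MoverWins t κ ⟨[], b, a + ((t []).2 : ℤ)⟩} :=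
  measurableSet_mem_root_weight (Q := fun e => {t | MoverWins t κ ⟨[], b, a + (e : ℤ)⟩})
    fun _ => measurableSet_moverWins κ _

lemma measurableSet_not_moverLoses_root_weight (κ : ℕ) (a b : ℤ) :
    MeasurableSet {t : WTree | ¬ MoverLoses t κ ⟨[], b, a + ((t []).2 : ℤ)⟩} :=
  measurableSet_mem_root_weight (Q := fun e => {t | MoverLoses t κ ⟨[], b, a + (e : ℤ)⟩}ᶜ)
    fun _ => (measurableSet_moverLoses κ _).compl

lemma rootIndep_moverLoses_of_undecided (κ : ℕ) (a b : ℤ) (hab : Undecided κ a b) :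
    RootIndep χ p {t | MoverLoses t κ ⟨[], a, b⟩} ∧
      (treeLaw χ p).real {t | MoverLoses t κ ⟨[], a, b⟩} =
        pgf χ ((treeLaw χ p).real {t | MoverWins t κ ⟨[], b, a + ((t []).2 : ℤ)⟩}) := by
  simp only [moverLoses_root_iff _ κ a b hab]
  exact rootIndep_forall_subtree χ p (measurableSet_moverWins_root_weight κ a b)

lemma rootIndep_not_moverWins_of_undecided (κ : ℕ) (a b : ℤ) (hab : Undecided κ a b) :
    RootIndep χ p {t | ¬ MoverWins t κ ⟨[], a, b⟩} ∧
      (treeLaw χ p).real {t | ¬ MoverWins t κ ⟨[], a, b⟩} =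
        pgf χ ((treeLaw χ p).real {t | ¬ MoverLoses t κ ⟨[], b, a + ((t []).2 : ℤ)⟩}) := by
  simp only [not_moverWins_root_iff _ κ a b hab]
  exact rootIndep_forall_subtree χ p (measurableSet_not_moverLoses_root_weight κ a b)

lemma moverWins_broke (t : WTree) (κ : ℕ) (v : List ℕ) (a : ℤ) : MoverWins t κ ⟨v, a, 0⟩ :=
  (moverWins_iff ..).2 (Or.inl (Or.inl rfl))

lemma not_moverWins_target (t : WTree) (κ : ℕ) (v : List ℕ) (a : ℤ) (ha : a ≠ κ) (hκ : κ ≠ 0) :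
    ¬ MoverWins t κ ⟨v, a, κ⟩ := by
  rw [moverWins_iff]
  simp [MoverHasWon, Over, MoverHasLost, ha, hκ]

lemma moverLoses_target (t : WTree) (κ : ℕ) (v : List ℕ) (a : ℤ) : MoverLoses t κ ⟨v, a, κ⟩ :=
  (moverLoses_iff ..).2 (Or.inl (Or.inr (Or.inl rfl)))

lemma not_moverLoses_broke (t : WTree) (κ : ℕ) (v : List ℕ) (a : ℤ) (ha : a ≠ 0) (hκ : κ ≠ 0) :
    ¬ MoverLoses t κ ⟨v, a, 0⟩ := by
  rw [moverLoses_iff]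
  simp [MoverHasWon, Over, MoverHasLost, ha, eq_comm (a := (0 : ℤ)), hκ]

lemma rootIndep_moverLoses (κ : ℕ) (a b : ℤ) (ha : a ≠ 0) (ha' : a ≠ κ) (hκ : κ ≠ 0) :
    RootIndep χ p {t | MoverLoses t κ ⟨[], a, b⟩} := by
  by_cases hb : b = 0
  · subst hb
    simpa [not_moverLoses_broke _ κ _ a ha hκ] using rootIndep_empty χ p
  by_cases hb' : b = κ
  · subst hb'
    simpa [moverLoses_target] using rootIndep_univ χ p
  exact (rootIndep_moverLoses_of_undecided χ p κ a b ⟨⟨ha, ha'⟩, hb, hb'⟩).1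

lemma rootIndep_moverWins (κ : ℕ) (a b : ℤ) (ha : a ≠ 0) (ha' : a ≠ κ) (hκ : κ ≠ 0) :
    RootIndep χ p {t | MoverWins t κ ⟨[], a, b⟩} := by
  by_cases hb : b = 0
  · subst hb
    simpa [moverWins_broke] using rootIndep_univ χ p
  by_cases hb' : b = κ
  · subst hb'
    simpa [not_moverWins_target _ κ _ a ha' hκ] using rootIndep_empty χ p
  have h := (rootIndep_not_moverWins_of_undecided χ p κ a b ⟨⟨ha, ha'⟩, hb, hb'⟩).1.compl
  have hc : {t | ¬ MoverWins t κ ⟨[], a, b⟩}ᶜ = {t | MoverWins t κ ⟨[], a, b⟩} := by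
    ext t; simp
  rwa [hc] at h

/-- The probability that the player whose turn it is loses satisfies the recursion over the
weight of the first edge. -/
theorem lossProb_eq (κ : ℕ) (a b : ℤ) (hab : Undecided κ a b) (hκ : κ ≠ 0) :
    lossProb χ p κ a b = pgf χ (pm p * winProb χ p κ b (a - 1) + pz p * winProb χ p κ b a +
      pp p * winProb χ p κ b (a + 1)) := by
  simp only [lossProb, winProb, wins_iff, loses_iff]
  rw [(rootIndep_moverLoses_of_undecided χ p κ a b hab).2]
  have h := real_eq_sum (χ := χ) (p := p) (Q := fun e => {t | MoverWins t κ ⟨[], b, a + (e : ℤ)⟩})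
    fun e => rootIndep_moverWins χ p κ _ _ hab.2.1 hab.2.2 hκ
  simp only [SignType.coe_neg_one, SignType.coe_zero, SignType.coe_one, add_zero,
    ← sub_eq_add_neg] at h
  rw [← h]
  rfl

/-- The probability that the player whose turn it is does not win satisfies the recursion over the
weight of the first edge. -/
theorem one_sub_winProb_eq (κ : ℕ) (a b : ℤ) (hab : Undecided κ a b) (hκ : κ ≠ 0) :
    1 - winProb χ p κ a b = pgf χ (pm p * (1 - lossProb χ p κ b (a - 1)) +
      pz p * (1 - lossProb χ p κ b a) + pp p * (1 - lossProb χ p κ b (a + 1))) := by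
  simp only [lossProb, winProb, wins_iff, loses_iff]
  have hc (a b : ℤ) := probReal_compl_eq_one_sub (μ := treeLaw χ p)
    (measurableSet_moverLoses κ ⟨[], a, b⟩)
  rw [← probReal_compl_eq_one_sub (measurableSet_moverWins κ _)]
  refine (rootIndep_not_moverWins_of_undecided χ p κ a b hab).2.trans ?_
  have h := real_eq_sum (χ := χ) (p := p)
    (Q := fun e => {t | MoverLoses t κ ⟨[], b, a + (e : ℤ)⟩}ᶜ)
    fun e => (rootIndep_moverLoses χ p κ _ _ hab.2.1 hab.2.2 hκ).compl
  simp only [SignType.coe_neg_one, SignType.coe_zero, SignType.coe_one, add_zero,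
    ← sub_eq_add_neg, hc] at h
  rw [← h]
  rfl

theorem drawProb_eq (κ : ℕ) (a b : ℤ) (ha : a ≠ 0) (ha' : a ≠ κ) (hκ : κ ≠ 0) :
    drawProb χ p κ a b = 1 - winProb χ p κ a b - lossProb χ p κ a b := by
  simp only [drawProb, Draws, winProb, lossProb, wins_iff, loses_iff]
  have h : {t | ¬ MoverWins t κ ⟨[], a, b⟩ ∧ ¬ MoverLoses t κ ⟨[], a, b⟩} =
      {t | ¬ MoverWins t κ ⟨[], a, b⟩} \ {t | MoverLoses t κ ⟨[], a, b⟩} := rfl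
  rw [h, measureReal_sdiff, ← probReal_compl_eq_one_sub (measurableSet_moverWins κ _)]
  · rfl
  · exact fun t ht hw => not_moverWins_and_moverLoses t κ hκ _ ha ha' ⟨hw, ht⟩
  · exact measurableSet_moverLoses κ _

lemma winProb_broke (κ : ℕ) (a : ℤ) : winProb χ p κ a 0 = 1 := by
  simp [winProb, wins_iff, moverWins_broke]

lemma winProb_target (κ : ℕ) (a : ℤ) (ha : a ≠ κ) (hκ : κ ≠ 0) : winProb χ p κ a κ = 0 := by
  simp [winProb, wins_iff, not_moverWins_target _ κ _ a ha hκ]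

lemma lossProb_target (κ : ℕ) (a : ℤ) : lossProb χ p κ a κ = 1 := by
  simp [lossProb, loses_iff, moverLoses_target]

lemma lossProb_broke (κ : ℕ) (a : ℤ) (ha : a ≠ 0) (hκ : κ ≠ 0) : lossProb χ p κ a 0 = 0 := by
  simp [lossProb, loses_iff, not_moverLoses_broke _ κ _ a ha hκ]

end Recursion

/-! ### Convex functions on the unit interval -/

/-- Both `x` and `y` are convex combinations of `w` and `x + y - w`, with the two weights
interchanged; adding the two convexity inequalities gives the claim. -/
lemma _root_.ConvexOn.add_le_add_of_le {f : ℝ → ℝ} {s : Set ℝ} (hf : ConvexOn ℝ s f) {w x y : ℝ}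
    (hw : w ∈ s) (hwx : w ≤ x) (hwy : w ≤ y) (hs : x + y - w ∈ s) :
    f x + f y ≤ f w + f (x + y - w) := by
  rcases hwx.eq_or_lt with rfl | hx
  · simp
  have hd : 0 < x + y - 2 * w := by linarith
  obtain ⟨u, v, hu, hv, huv, hue, hve⟩ : ∃ u v : ℝ, 0 ≤ u ∧ 0 ≤ v ∧ u + v = 1 ∧
      u * (x + y - 2 * w) = y - w ∧ v * (x + y - 2 * w) = x - w := by
    refine ⟨(y - w) / (x + y - 2 * w), (x - w) / (x + y - 2 * w), div_nonneg (by linarith) hd.le,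
      div_nonneg (by linarith) hd.le, ?_, div_mul_cancel₀ _ hd.ne', div_mul_cancel₀ _ hd.ne'⟩
    rw [← add_div, div_eq_one_iff_eq hd.ne']
    ring
  have h1 := hf.2 hw hs hu hv huv
  have h2 := hf.2 hw hs hv hu (by linarith)
  simp only [smul_eq_mul] at h1 h2
  rw [show u * w + v * (x + y - w) = x by linear_combination w * huv + hve] at h1
  rw [show v * w + u * (x + y - w) = y by linear_combination w * huv + hue] at h2
  calc f x + f y ≤ (u + v) * (f w + f (x + y - w)) := by linarith
    _ = _ := by rw [huv, one_mul]

/-- The secants of a convex function to the left of `z` are bounded by any derivative at `z` within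
a nontrivial interval. -/
lemma _root_.ConvexOn.sub_le_of_hasDerivWithinAt_Icc {f : ℝ → ℝ} {s : Set ℝ} (hf : ConvexOn ℝ s f)
    {l r z M : ℝ} (hlr : l < r) (hz : z ∈ Set.Icc l r) (hs : Set.Icc l r ⊆ s)
    (hd : HasDerivWithinAt f M (Set.Icc l r) z) {x y : ℝ} (hx : x ∈ s) (hxy : x ≤ y) (hyz : y ≤ z) :
    f y - f x ≤ M * (y - x) := by
  rcases hxy.eq_or_lt with rfl | hxy'
  · simp
  have hzs : z ∈ s := hs hz
  have hys : y ∈ s := hf.1.ordConnected.out hx hzs ⟨hxy, hyz⟩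
  have hxz : x < z := hxy'.trans_le hyz
  have hM : (f x - f z) / (x - z) ≤ M := by
    have ht := hasDerivWithinAt_iff_tendsto_slope.1 hd
    -- The point `z` may be an end point of the interval, so the derivative may be one-sided on
    -- either side. Secants from `z` to points on its right are steeper still, so the bound survives
    -- in the limit.
    have hne : (nhdsWithin z (Set.Icc l r \ {z})).NeBot := by
      rw [← accPt_principal_iff_nhdsWithin]
      have hnt : (Set.Icc l r).Nontrivial := ⟨l, ⟨le_rfl, hlr.le⟩, r, ⟨hlr.le, le_rfl⟩, hlr.ne⟩
      exact (convex_Icc l r).isPreconnected.preperfect_of_nontrivial hnt z hz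
    refine ge_of_tendsto ht ?_
    filter_upwards [self_mem_nhdsWithin, mem_nhdsWithin_of_mem_nhds (Ioi_mem_nhds hxz)] with w hw hxw
    rw [slope_def_field]
    exact hf.secant_mono hzs hx (hs hw.1) hxz.ne hw.2 (le_of_lt hxw)
  have h2 : (f y - f x) / (y - x) ≤ (f z - f x) / (z - x) :=
    hf.secant_mono hx hys hzs hxy'.ne' hxz.ne' hyz
  rw [← neg_div_neg_eq, neg_sub, neg_sub] at hM
  exact (div_le_iff₀ (by linarith)).1 (h2.trans hM)

/-! ### The generating function -/

section Pgf

variable (χ : PMF ℕ)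

lemma summable_pgf {x : ℝ} (hx : x ∈ Set.Icc (0 : ℝ) 1) :
    Summable fun m : ℕ => x ^ m * (χ m).toReal := by
  have h : Summable fun m : ℕ => (χ m).toReal :=
    ENNReal.summable_toReal (by rw [χ.tsum_coe]; exact ENNReal.one_ne_top)
  refine h.of_nonneg_of_le (fun m => ?_) (fun m => ?_)
  · have := hx.1
    positivity
  · exact mul_le_of_le_one_left ENNReal.toReal_nonneg (pow_le_one₀ hx.1 hx.2)

lemma pgf_monotoneOn : MonotoneOn (pgf χ) (Set.Icc 0 1) := by
  intro x hx y hy hxy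
  refine (summable_pgf χ hx).tsum_le_tsum (fun m => ?_) (summable_pgf χ hy)
  exact mul_le_mul_of_nonneg_right (pow_le_pow_left₀ hx.1 hxy m) ENNReal.toReal_nonneg

lemma pgf_mono {x y : ℝ} (hx : 0 ≤ x) (hxy : x ≤ y) (hy : y ≤ 1) : pgf χ x ≤ pgf χ y :=
  pgf_monotoneOn χ ⟨hx, hxy.trans hy⟩ ⟨hx.trans hxy, hy⟩ hxy

lemma pgf_mem {x : ℝ} (hx : x ∈ Set.Icc (0 : ℝ) 1) : pgf χ x ∈ Set.Icc (0 : ℝ) 1 := by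
  refine ⟨tsum_nonneg fun m => ?_, ?_⟩
  · have := hx.1
    positivity
  · exact (pgf_mono χ hx.1 hx.2 le_rfl).trans (pgf_one χ).le

lemma pgf_convexOn : ConvexOn ℝ (Set.Icc 0 1) (pgf χ) := by
  refine ⟨convex_Icc 0 1, fun x hx y hy a b ha hb hab => ?_⟩
  have hx' := (summable_pgf χ hx).mul_left a
  have hy' := (summable_pgf χ hy).mul_left b
  simp only [smul_eq_mul, pgf, ← tsum_mul_left]
  rw [← hx'.tsum_add hy']
  refine (summable_pgf χ (convex_Icc 0 1 hx hy ha hb hab)).tsum_le_tsum (fun m => ?_) (hx'.add hy')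
  have h := (convexOn_pow (𝕜 := ℝ) m).2 (Set.mem_Ici.2 hx.1) (Set.mem_Ici.2 hy.1) ha hb hab
  simp only [smul_eq_mul] at h
  calc (a * x + b * y) ^ m * (χ m).toReal ≤ (a * x ^ m + b * y ^ m) * (χ m).toReal :=
        mul_le_mul_of_nonneg_right h ENNReal.toReal_nonneg
    _ = _ := by ring

lemma pgf'_nonneg (x : ℝ) : 0 ≤ pgf' χ x := (pgf_monotoneOn χ).derivWithin_nonneg

lemma abs_pgf_sub_le {x y z : ℝ} (hz : z ∈ Set.Icc (0 : ℝ) 1) (hx : 0 ≤ x) (hy : 0 ≤ y)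
    (hxz : x ≤ z) (hyz : y ≤ z) (hd : DifferentiableWithinAt ℝ (pgf χ) (Set.Icc 0 1) z) :
    |pgf χ x - pgf χ y| ≤ pgf' χ z * |x - y| := by
  wlog hxy : y ≤ x generalizing x y
  · rw [abs_sub_comm, abs_sub_comm x]
    exact this hy hx hyz hxz (le_of_not_ge hxy)
  rw [abs_of_nonneg (sub_nonneg.2 hxy),
    abs_of_nonneg (sub_nonneg.2 (pgf_mono χ hy hxy (hxz.trans hz.2)))]
  exact (pgf_convexOn χ).sub_le_of_hasDerivWithinAt_Icc one_pos hz subset_rfl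
    hd.hasDerivWithinAt ⟨hy, hyz.trans hz.2⟩ hxy hxz

/-- The composition of the generating function with an affine function of two variables. -/
noncomputable def affinePgf (c : ℝ) (α : Fin 2 → ℝ) (x : Fin 2 → ℝ) : ℝ :=
  pgf χ (c - α 1 * x 1 - α 0 * x 0)

variable {χ} {c : ℝ} {α : Fin 2 → ℝ}

lemma affine_mem (hα : ∀ j, 0 ≤ α j) (hc : α 0 + α 1 ≤ c) (hc1 : c ≤ 1) {x : Fin 2 → ℝ}
    (hx : ∀ j, x j ∈ Set.Icc (0 : ℝ) 1) :
    c - α 1 * x 1 - α 0 * x 0 ∈ Set.Icc (0 : ℝ) 1 := by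
  have h0 := mul_nonneg (hα 0) (hx 0).1
  have h1 := mul_nonneg (hα 1) (hx 1).1
  have h0' := mul_le_of_le_one_right (hα 0) (hx 0).2
  have h1' := mul_le_of_le_one_right (hα 1) (hx 1).2
  exact ⟨by linarith, by linarith⟩

lemma affinePgf_mem (hα : ∀ j, 0 ≤ α j) (hc : α 0 + α 1 ≤ c) (hc1 : c ≤ 1) {x : Fin 2 → ℝ}
    (hx : ∀ j, x j ∈ Set.Icc (0 : ℝ) 1) : affinePgf χ c α x ∈ Set.Icc (0 : ℝ) 1 :=
  pgf_mem χ (affine_mem hα hc hc1 hx)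

lemma affinePgf_anti (hα : ∀ j, 0 ≤ α j) (hc : α 0 + α 1 ≤ c) (hc1 : c ≤ 1) {x y : Fin 2 → ℝ}
    (hx : ∀ j, x j ∈ Set.Icc (0 : ℝ) 1) (hy : ∀ j, y j ∈ Set.Icc (0 : ℝ) 1) (hxy : ∀ j, x j ≤ y j) :
    affinePgf χ c α y ≤ affinePgf χ c α x := by
  refine pgf_mono χ (affine_mem hα hc hc1 hy).1 ?_ (affine_mem hα hc hc1 hx).2
  have h0 := mul_le_mul_of_nonneg_left (hxy 0) (hα 0)
  have h1 := mul_le_mul_of_nonneg_left (hxy 1) (hα 1)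
  linarith

lemma slice_affinePgf (a : Fin 2 → ℝ) (j : Fin 2) (s : ℝ) :
    slice (affinePgf χ c α) a j s = pgf χ (c - α 1 * a 1 - α 0 * a 0 - α j * (s - a j)) := by
  unfold slice affinePgf
  congr 1
  fin_cases j <;> simp <;> ring

/-- Morally the partial derivative is `-α j` times the derivative of the generating function at `z`.
Only the slice is assumed differentiable, so its affine parametrization is inverted; this yields a
derivative within the image of [0, 1], a subinterval containing `z`, which suffices by convexity. If
`α j = 0`, both sides vanish. -/
lemma mul_pgf_sub_le (hα : ∀ j, 0 ≤ α j) (hc : α 0 + α 1 ≤ c) (hc1 : c ≤ 1) {a : Fin 2 → ℝ}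
    (ha : ∀ j, a j ∈ Set.Icc (0 : ℝ) 1) (j : Fin 2)
    (hd : DifferentiableWithinAt ℝ (slice (affinePgf χ c α) a j) (Set.Icc 0 1) (a j)) {x y : ℝ}
    (hx : 0 ≤ x) (hxy : x ≤ y) (hy : y ≤ c - α 1 * a 1 - α 0 * a 0) :
    α j * (pgf χ y - pgf χ x) ≤ -pderiv (affinePgf χ c α) j a * (y - x) := by
  set z := c - α 1 * a 1 - α 0 * a 0 with hz
  have hz1 : z ∈ Set.Icc (0 : ℝ) 1 := affine_mem hα hc hc1 ha
  rcases (hα j).eq_or_lt with h0 | hpos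
  · have hconst : slice (affinePgf χ c α) a j = fun _ => pgf χ z := by
      ext s; rw [slice_affinePgf, ← h0, zero_mul, sub_zero]
    simp [pderiv, hconst, ← h0]
  have hupd (s : ℝ) (hs : s ∈ Set.Icc (0 : ℝ) 1) : z - α j * (s - a j) ∈ Set.Icc (0 : ℝ) 1 := by
    have h := affine_mem hα hc hc1 (x := Function.update a j s) fun k => by
      by_cases hk : k = j
      · subst hk; simpa using hs
      · simpa [hk] using ha k
    convert h using 1
    rw [hz]
    fin_cases j <;> simp <;> ring
  have hT : Set.Icc (z - α j * (1 - a j)) (z - α j * (0 - a j)) ⊆ Set.Icc 0 1 :=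
    Set.Icc_subset_Icc (hupd 1 (by simp)).1 (hupd 0 (by simp)).2
  have hψ : HasDerivWithinAt (fun w => a j - (w - z) / α j) (-(1 / α j))
      (Set.Icc (z - α j * (1 - a j)) (z - α j * (0 - a j))) z :=
    (((hasDerivAt_id z).sub_const z).div_const (α j) |>.const_sub (a j)).hasDerivWithinAt
  have hmaps : Set.MapsTo (fun w => a j - (w - z) / α j)
      (Set.Icc (z - α j * (1 - a j)) (z - α j * (0 - a j))) (Set.Icc 0 1) := by
    intro w hw
    have h1 : (w - z) / α j ≤ a j := by rw [div_le_iff₀ hpos]; linarith [hw.2]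
    have h2 : a j - 1 ≤ (w - z) / α j := by rw [le_div_iff₀ hpos]; linarith [hw.1]
    exact ⟨by linarith, by linarith⟩
  have hG : HasDerivWithinAt (pgf χ) (pderiv (affinePgf χ c α) j a * -(1 / α j))
      (Set.Icc (z - α j * (1 - a j)) (z - α j * (0 - a j))) z := by
    have hd' : HasDerivWithinAt (slice (affinePgf χ c α) a j) (pderiv (affinePgf χ c α) j a)
        (Set.Icc 0 1) (a j - (z - z) / α j) := by
      rw [sub_self, zero_div, sub_zero]
      exact hd.hasDerivWithinAt
    have hcomp : slice (affinePgf χ c α) a j ∘ (fun w => a j - (w - z) / α j) = pgf χ := by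
      ext w
      simp only [Function.comp, slice_affinePgf]
      rw [← hz]
      congr 1
      field_simp
      ring
    rw [← hcomp]
    exact HasDerivWithinAt.comp z hd' hψ hmaps
  have hle := (pgf_convexOn χ).sub_le_of_hasDerivWithinAt_Icc
    (by linarith) ⟨by nlinarith [(ha j).2], by nlinarith [(ha j).1]⟩ hT hG
    ⟨hx, hxy.trans (hy.trans hz1.2)⟩ hxy hy
  calc α j * (pgf χ y - pgf χ x)
      ≤ α j * (pderiv (affinePgf χ c α) j a * -(1 / α j) * (y - x)) :=
        mul_le_mul_of_nonneg_left hle (hα j)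
    _ = _ := by field_simp

lemma abs_pgf_affine_sub_le (hα : ∀ j, 0 ≤ α j) (hc : α 0 + α 1 ≤ c) (hc1 : c ≤ 1) {a : Fin 2 → ℝ}
    (ha : ∀ j, a j ∈ Set.Icc (0 : ℝ) 1) (j : Fin 2)
    (hd : DifferentiableWithinAt ℝ (slice (affinePgf χ c α) a j) (Set.Icc 0 1) (a j)) {x y s : ℝ}
    (hx : 0 ≤ x) (hy : 0 ≤ y) (hxz : x ≤ c - α 1 * a 1 - α 0 * a 0)
    (hyz : y ≤ c - α 1 * a 1 - α 0 * a 0) (hs : y - x = α j * s) :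
    |pgf χ x - pgf χ y| ≤ -pderiv (affinePgf χ c α) j a * |s| := by
  wlog hxy : y ≤ x generalizing x y s
  · have h := this hy hx hyz hxz (s := -s) (by linarith) (le_of_not_ge hxy)
    rwa [abs_sub_comm, abs_neg] at h
  have hz := affine_mem hα hc hc1 ha
  have h := mul_pgf_sub_le hα hc hc1 ha j hd hy hxy hxz
  rw [abs_of_nonneg (sub_nonneg.2 (pgf_mono χ hy hxy (hxz.trans hz.2)))]
  rcases (hα j).eq_or_lt with h0 | hpos
  · have hconst : slice (affinePgf χ c α) a j =
        fun _ => pgf χ (c - α 1 * a 1 - α 0 * a 0) := by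
      ext s; rw [slice_affinePgf, ← h0, zero_mul, sub_zero]
    have hxy' : x = y := by rw [← h0] at hs; linarith
    simp [pderiv, hconst, hxy']
  · have hs' : s ≤ 0 := by
      by_contra! hs'
      have := mul_pos hpos hs'
      linarith
    rw [abs_of_nonpos hs']
    have h3 : x - y = α j * -s := by linarith
    rw [h3] at h
    refine le_of_mul_le_mul_left (h.trans_eq ?_) hpos
    ring

/-- Above the point `a`, the function `affinePgf χ c α` is Lipschitz in each variable with constant
minus the partial derivative at `a`. -/
lemma abs_affinePgf_sub_le (hα : ∀ j, 0 ≤ α j) (hc : α 0 + α 1 ≤ c) (hc1 : c ≤ 1) {a : Fin 2 → ℝ}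
    (ha : ∀ j, a j ∈ Set.Icc (0 : ℝ) 1)
    (hd : ∀ j, DifferentiableWithinAt ℝ (slice (affinePgf χ c α) a j) (Set.Icc 0 1) (a j))
    {x y : Fin 2 → ℝ} (hx : ∀ j, x j ∈ Set.Icc (a j) 1) (hy : ∀ j, y j ∈ Set.Icc (a j) 1) :
    |affinePgf χ c α x - affinePgf χ c α y| ≤
      -pderiv (affinePgf χ c α) 0 a * |x 0 - y 0| +
        -pderiv (affinePgf χ c α) 1 a * |x 1 - y 1| := by
  have hbd (u : Fin 2 → ℝ) (hu : ∀ j, u j ∈ Set.Icc (a j) 1) :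
      0 ≤ c - α 1 * u 1 - α 0 * u 0 ∧
        c - α 1 * u 1 - α 0 * u 0 ≤ c - α 1 * a 1 - α 0 * a 0 := by
    refine ⟨(affine_mem hα hc hc1 fun j => ⟨(ha j).1.trans (hu j).1, (hu j).2⟩).1, ?_⟩
    have h0 := mul_le_mul_of_nonneg_left (hu 0).1 (hα 0)
    have h1 := mul_le_mul_of_nonneg_left (hu 1).1 (hα 1)
    linarith
  -- The variables are changed one at a time, through this intermediate point.
  have hw := hbd ![y 0, x 1] fun j => by
    fin_cases j
    · exact hy 0
    · exact hx 1
  simp only [Matrix.cons_val_zero, Matrix.cons_val_one] at hw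
  have h0 := abs_pgf_affine_sub_le hα hc hc1 ha 0 (hd 0) (hbd x hx).1 hw.1 (hbd x hx).2 hw.2
    (s := x 0 - y 0) (by ring)
  have h1 := abs_pgf_affine_sub_le hα hc hc1 ha 1 (hd 1) hw.1 (hbd y hy).1 hw.2 (hbd y hy).2
    (s := x 1 - y 1) (by ring)
  exact (abs_sub_le _ _ _).trans (add_le_add h0 h1)

end Pgf

/-! ### The fixed point map as a square -/

section FixedPoint

variable (χ : PMF ℕ) (p : PMF SignType)

lemma pm_nonneg : 0 ≤ pm p := ENNReal.toReal_nonneg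

lemma pz_nonneg : 0 ≤ pz p := ENNReal.toReal_nonneg

lemma pp_nonneg : 0 ≤ pp p := ENNReal.toReal_nonneg

/-- The constant terms of the affine functions in `f1` and `f2`. -/
noncomputable def rowConst (r : Fin 2) : ℝ := ![1, pz p + pm p] r

/-- The coefficients of the affine functions in `f1` and `f2`. -/
noncomputable def rowCoeff (r : Fin 2) : Fin 2 → ℝ := ![![pz p, pp p], ![pm p, pz p]] r

/-- The functions `f1` and `f2` as a family. -/
noncomputable def rowFun (r : Fin 2) : (Fin 2 → ℝ) → ℝ :=
  affinePgf χ (rowConst p r) (rowCoeff p r)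

lemma rowFun_zero : rowFun χ p 0 = f1 χ p := rfl

lemma rowFun_one : rowFun χ p 1 = f2 χ p := rfl

lemma rowCoeff_nonneg (r j : Fin 2) : 0 ≤ rowCoeff p r j := by
  have := pm_nonneg p
  have := pz_nonneg p
  have := pp_nonneg p
  fin_cases r <;> fin_cases j <;> simpa [rowCoeff]

lemma rowCoeff_add_le (r : Fin 2) : rowCoeff p r 0 + rowCoeff p r 1 ≤ rowConst p r := by
  have := sum_toReal_pmf_signType p
  have := pm_nonneg p
  fin_cases r <;> simp [rowCoeff, rowConst] <;> linarith

lemma rowConst_le_one (r : Fin 2) : rowConst p r ≤ 1 := by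
  have := sum_toReal_pmf_signType p
  have := pp_nonneg p
  fin_cases r <;> simp [rowConst]; linarith

/-- The map that expresses the matrix of loss probabilities through the matrix of the probabilities
not to win, and conversely. -/
noncomputable def halfStep (X : Matrix (Fin 2) (Fin 2) ℝ) : Matrix (Fin 2) (Fin 2) ℝ :=
  Matrix.of fun r j => rowFun χ p r (X j)

variable {χ p} in
lemma rowFun_mem {x : Fin 2 → ℝ} (hx : ∀ j, x j ∈ Set.Icc (0 : ℝ) 1) (r : Fin 2) :
    rowFun χ p r x ∈ Set.Icc (0 : ℝ) 1 :=
  affinePgf_mem (rowCoeff_nonneg p r) (rowCoeff_add_le p r) (rowConst_le_one p r) hx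

variable {χ p} in
lemma halfStep_mem {X : Matrix (Fin 2) (Fin 2) ℝ} (hX : X ∈ unitMatrices 2) :
    halfStep χ p X ∈ unitMatrices 2 :=
  fun r j => rowFun_mem (hX j) r

/-- The inner matrix in `h` is the transpose of `halfStep χ p X`: the players exchange roles after
each move. The rank-one terms account for going broke from capital 1. -/
lemma h_eq_halfStep_halfStep (X : Matrix (Fin 2) (Fin 2) ℝ) :
    h χ p 2 X = halfStep χ p (halfStep χ p X) := by
  have hp : pp p = 1 - pm p - pz p := by linarith [sum_toReal_pmf_signType p]
  have hinner : ((pm p • Matrix.vecMulVec 1 (e1 2) +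
      ((Matrix.of fun _ _ => 1) - X) * (stepMatrix p 2).transpose).map (pgf χ)) =
      (halfStep χ p X).transpose := by
    ext i j
    fin_cases i <;> fin_cases j <;>
    simp only [halfStep, rowFun, affinePgf, rowConst, rowCoeff, stepMatrix, e1, Matrix.mul_apply,
      Fin.sum_univ_two, Matrix.vecMulVec_apply, Matrix.map_apply, Matrix.add_apply,
      Matrix.smul_apply, Matrix.sub_apply, Matrix.transpose_apply, Matrix.of_apply] <;>
    congr 1 <;> simp [hp] <;> ring
  simp only [h]
  rw [hinner]
  ext i j
  fin_cases i <;> fin_cases j <;>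
  simp only [halfStep, rowFun, affinePgf, rowConst, rowCoeff, stepMatrix, e1, Matrix.mul_apply,
    Fin.sum_univ_two, Matrix.vecMulVec_apply, Matrix.map_apply, Matrix.add_apply,
    Matrix.smul_apply, Matrix.sub_apply, Matrix.transpose_apply, Matrix.of_apply] <;>
  congr 1 <;> simp [hp] <;> ring

/-! ### The explicit bounds -/

variable {χ p}

/-- Both matrices of a pair that is exchanged by `halfStep` lie between `A` and `B`. -/
theorem bounds_of_halfStep {X Y : Matrix (Fin 2) (Fin 2) ℝ} (hX : X ∈ unitMatrices 2)
    (hY : Y ∈ unitMatrices 2) (hXY : X = halfStep χ p Y) (hYX : Y = halfStep χ p X) (i j : Fin 2) :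
    (0 ≤ A χ p i j ∧ A χ p i j ≤ X i j) ∧ X i j ≤ B χ p i j ∧ B χ p i j ≤ 1 := by
  have hsum := sum_toReal_pmf_signType p
  have hm := pm_nonneg p
  have hz := pz_nonneg p
  have ho := pp_nonneg p
  have eq0 {U V : Matrix (Fin 2) (Fin 2) ℝ} (hUV : U = halfStep χ p V) (j : Fin 2) :
      U 0 j = pgf χ (1 - pp p * V j 1 - pz p * V j 0) := by rw [hUV]; rfl
  have eq1 {U V : Matrix (Fin 2) (Fin 2) ℝ} (hUV : U = halfStep χ p V) (j : Fin 2) :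
      U 1 j = pgf χ (pz p + pm p - pz p * V j 1 - pm p * V j 0) := by rw [hUV]; rfl
  set m := pm p
  set z := pz p
  set o := pp p
  have hmul {a x y : ℝ} (ha : 0 ≤ a) (hxy : x ≤ y) : a * x ≤ a * y :=
    mul_le_mul_of_nonneg_left hxy ha
  have hG {x : ℝ} (h0 : 0 ≤ x) (h1 : x ≤ 1) : 0 ≤ pgf χ x ∧ pgf χ x ≤ 1 := pgf_mem χ ⟨h0, h1⟩
  have mono {x y : ℝ} (h0 : 0 ≤ x) (hxy : x ≤ y) (h1 : y ≤ 1) : pgf χ x ≤ pgf χ y :=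
    pgf_mono χ h0 hxy h1
  have super {w x y : ℝ} (hw : 0 ≤ w) (hwx : w ≤ x) (hwy : w ≤ y) (h1 : x + y - w ≤ 1) :
      pgf χ x + pgf χ y ≤ pgf χ w + pgf χ (x + y - w) :=
    (pgf_convexOn χ).add_le_add_of_le ⟨hw, by linarith⟩ hwx hwy ⟨by linarith, h1⟩
  have hq := hG hm (by linarith : m ≤ 1)
  have hb := hG (by linarith : 0 ≤ 1 - o) (by linarith)
  set q := pgf χ m with hqdef
  obtain ⟨b, hbdef⟩ : ∃ b, b = 1 - pgf χ (1 - o) := ⟨_, rfl⟩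
  have hb0 : 0 ≤ b := by linarith
  have hb1 : b ≤ 1 := by linarith
  have lower0 {U V : Matrix (Fin 2) (Fin 2) ℝ} (hV : V ∈ unitMatrices 2)
      (hUV : U = halfStep χ p V) (j : Fin 2) : q ≤ U 0 j := by
    rw [eq0 hUV]
    have h1 := hmul ho (hV j 1).2
    have h2 := hmul hz (hV j 0).2
    have h3 := mul_nonneg ho (hV j 1).1
    have h4 := mul_nonneg hz (hV j 0).1
    exact mono hm (by linarith) (by linarith)
  have upper1 {U V : Matrix (Fin 2) (Fin 2) ℝ} (hV : V ∈ unitMatrices 2)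
      (hUV : U = halfStep χ p V) (j : Fin 2) : U 1 j ≤ 1 - b := by
    rw [eq1 hUV, hbdef, sub_sub_cancel]
    have h1 := hmul hz (hV j 1).2
    have h2 := hmul hm (hV j 0).2
    have h3 := mul_nonneg hz (hV j 1).1
    have h4 := mul_nonneg hm (hV j 0).1
    exact mono (by linarith) (by linarith) (by linarith)
  have hX0 := lower0 hY hXY
  have hY0 := lower0 hX hYX
  have hX1 := upper1 hY hXY
  have hY1 := upper1 hX hYX
  have distrib (x : ℝ) : (1 - m) * x = o * x + z * x := by linear_combination -x * hsum
  have distrib' (x : ℝ) : (1 - o) * x = z * x + m * x := by linear_combination -x * hsum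
  -- the entries of `A`
  have hA10 : 0 ≤ pgf χ (m * (1 - pgf χ (1 - (1 - m) * q))) ∧
      pgf χ (m * (1 - pgf χ (1 - (1 - m) * q))) ≤ X 1 0 := by
    have hle : Y 0 0 ≤ pgf χ (1 - (1 - m) * q) := by
      rw [eq0 hYX, distrib]
      have h1 := hmul ho (hX0 1)
      have h2 := hmul hz (hX0 0)
      have h3 := hmul ho (hX 0 1).2
      have h4 := hmul hz (hX 0 0).2
      have h5 := mul_nonneg ho hq.1
      have h6 := mul_nonneg hz hq.1
      exact mono (by linarith) (by linarith) (by linarith)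
    have hr : 0 ≤ pgf χ (1 - (1 - m) * q) ∧ pgf χ (1 - (1 - m) * q) ≤ 1 := by
      have h1 : 0 ≤ (1 - m) * q := mul_nonneg (by linarith) hq.1
      have h2 : (1 - m) * q ≤ 1 := mul_le_one₀ (by linarith) hq.1 hq.2
      exact hG (by linarith) (by linarith)
    refine ⟨(hG (mul_nonneg hm (by linarith))
      (mul_le_one₀ (by linarith) (by linarith) (by linarith))).1, ?_⟩
    rw [eq1 hXY]
    have h1 := hmul hm hle
    have h2 := hmul hz (hY 0 1).2
    have h3 := mul_nonneg hz (hY 0 1).1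
    have h4 := mul_nonneg hm (hY 0 0).1
    refine mono (mul_nonneg hm (by linarith)) ?_ (by linarith)
    rw [mul_sub, mul_one]
    linarith
  -- Convexity with `w = (1 - o) * (1 - q)`; the top term is at most 1. This makes the argument of
  -- the subtracted term of the last entry of `A` nonnegative.
  have hc : 1 - b + pgf χ (1 - q) ≤ 1 + pgf χ ((1 - o) * (1 - q)) := by
    have h1 : 0 ≤ (1 - o) * (1 - q) := mul_nonneg (by linarith) (by linarith)
    have h2 : (1 - o) * (1 - q) ≤ 1 - o := mul_le_of_le_one_right (by linarith) (by linarith)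
    have h3 : (1 - o) * (1 - q) ≤ 1 - q := mul_le_of_le_one_left (by linarith) (by linarith)
    have h4 : 0 ≤ o * q := mul_nonneg ho hq.1
    have h5 : 1 - o + (1 - q) - (1 - o) * (1 - q) = 1 - o * q := by ring
    have h6 := super h1 h2 h3 (by linarith)
    have h7 := (hG (x := 1 - o + (1 - q) - (1 - o) * (1 - q)) (by linarith) (by linarith)).2
    linarith
  have ha := hG (by linarith : 0 ≤ 1 - q) (by linarith)
  have ha' : pgf χ ((1 - o) * (1 - q)) ≤ pgf χ (1 - q) :=
    mono (mul_nonneg (by linarith) (by linarith))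
      (mul_le_of_le_one_left (by linarith) (by linarith)) (by linarith)
  have hb' : pgf χ ((1 - o) * (1 - q)) ≤ 1 - b := by
    rw [hbdef, sub_sub_cancel]
    exact mono (mul_nonneg (by linarith) (by linarith))
      (mul_le_of_le_one_right (by linarith) (by linarith)) (by linarith)
  have hA11 : 0 ≤ pgf χ (m * (1 - pgf χ (1 - q))) + pgf χ ((1 - o) * b) -
      pgf χ (m * (b - pgf χ (1 - q) + pgf χ ((1 - o) * (1 - q)))) ∧
      pgf χ (m * (1 - pgf χ (1 - q))) + pgf χ ((1 - o) * b) -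
      pgf χ (m * (b - pgf χ (1 - q) + pgf χ ((1 - o) * (1 - q)))) ≤ X 1 1 := by
    have hle : Y 1 0 ≤ pgf χ ((1 - o) * (1 - q)) := by
      rw [eq1 hYX, distrib']
      have h1 := hmul hz (hX0 1)
      have h2 := hmul hm (hX0 0)
      have h3 := hmul hz (hX 0 1).2
      have h4 := hmul hm (hX 0 0).2
      have h5 := mul_nonneg hz hq.1
      have h6 := mul_nonneg hm hq.1
      exact mono (by linarith) (by linarith) (by linarith)
    have e1 := distrib' b
    have h1 := hmul hm (show b - pgf χ (1 - q) + pgf χ ((1 - o) * (1 - q)) ≤ 1 - pgf χ (1 - q) by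
      linarith)
    have h2 := hmul hm (show b - pgf χ (1 - q) + pgf χ ((1 - o) * (1 - q)) ≤ b by linarith)
    have h3 : 0 ≤ m * (b - pgf χ (1 - q) + pgf χ ((1 - o) * (1 - q))) :=
      mul_nonneg hm (by linarith)
    have h4 := mul_nonneg hz hb0
    have h5 := hmul hz hb1
    -- The right side is the argument that the bounds on `Y 1 1` and `Y 1 0` give directly.
    -- Convexity then bounds the generating function there from below by the three-term expression
    -- in `A`.
    have h6 : m * (1 - pgf χ (1 - q)) + (1 - o) * b -
        m * (b - pgf χ (1 - q) + pgf χ ((1 - o) * (1 - q))) =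
        z * b + m * (1 - pgf χ ((1 - o) * (1 - q))) := by
      rw [e1]; ring
    have h7 := hmul hm (show 1 - pgf χ ((1 - o) * (1 - q)) ≤ 1 by linarith [(hY 1 0).1])
    have h8 := super (y := (1 - o) * b) h3 h1 (by linarith) (by linarith)
    have h9 : pgf χ (z * b + m * (1 - pgf χ ((1 - o) * (1 - q)))) ≤ X 1 1 := by
      rw [eq1 hXY]
      have k1 := hmul hz (hY1 1)
      have k2 := hmul hm hle
      have k3 := mul_nonneg hz (hY 1 1).1
      have k4 := mul_nonneg hm (hY 1 0).1
      refine mono ?_ ?_ (by linarith)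
      · have : 0 ≤ m * (1 - pgf χ ((1 - o) * (1 - q))) := mul_nonneg hm (by linarith)
        linarith
      · rw [mul_sub, mul_one] at k1 ⊢
        linarith
    rw [h6] at h8
    have h10 := mono h3 h1 (mul_le_one₀ (by linarith) (by linarith) (by linarith))
    have h11 := (hG (x := (1 - o) * b) (mul_nonneg (by linarith) hb0)
      (mul_le_one₀ (by linarith) hb0 hb1)).1
    exact ⟨by linarith, by linarith⟩
  -- the entries of `B`
  have hbG := hG hb0 hb1
  have hB01 : X 0 1 ≤ pgf χ (1 - o * pgf χ ((1 - o) * b)) ∧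
      pgf χ (1 - o * pgf χ ((1 - o) * b)) ≤ 1 := by
    have hle : pgf χ ((1 - o) * b) ≤ Y 1 1 := by
      rw [eq1 hYX, distrib']
      have h1 := hmul hz (hX1 1)
      have h2 := hmul hm (hX1 0)
      have h3 := mul_nonneg hz (hX 1 1).1
      have h4 := mul_nonneg hm (hX 1 0).1
      have h5 := mul_nonneg hz hb0
      have h6 := mul_nonneg hm hb0
      exact mono (by linarith) (by linarith) (by linarith)
    rw [eq0 hXY]
    have h1 := hmul ho hle
    have h2 := mul_nonneg hz (hY 1 0).1
    have h3 := hmul ho (hY 1 1).2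
    have h4 := hmul hz (hY 1 0).2
    have h5 : 0 ≤ (1 - o) * b := mul_nonneg (by linarith) hb0
    have h6 := mul_nonneg ho
      (hG h5 (mul_le_one₀ (by linarith : 1 - o ≤ 1) hb0 hb1)).1
    exact ⟨mono (by linarith) (by linarith) (by linarith), (hG (by linarith) (by linarith)).2⟩
  have hB00 : X 0 0 ≤ pgf χ (1 - (1 - m) * q) - pgf χ ((1 - m) * (1 - q) + m) +
      pgf χ ((1 - m) * (1 - q) + m - o * pgf χ b + o * pgf χ (m * b)) ∧
      pgf χ (1 - (1 - m) * q) - pgf χ ((1 - m) * (1 - q) + m) +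
      pgf χ ((1 - m) * (1 - q) + m - o * pgf χ b + o * pgf χ (m * b)) ≤ 1 := by
    have hmb : 0 ≤ m * b := mul_nonneg hm hb0
    have hmb1 : m * b ≤ m := mul_le_of_le_one_right hm hb1
    have hmb2 : m * b ≤ b := mul_le_of_le_one_left hb0 (by linarith)
    have hmon : pgf χ (m * b) ≤ pgf χ b := mono hmb hmb2 hb1
    have e1 := distrib b
    have hsup := super hmb hmb1 hmb2 (by nlinarith)
    -- The bound on row 1 of `X` gives the argument `m + (1 - m) * b`, and convexity splits the
    -- value there into these three terms.
    have hle : q + pgf χ b - pgf χ (m * b) ≤ Y 0 1 := by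
      have : pgf χ (m + b - m * b) ≤ Y 0 1 := by
        rw [eq0 hYX]
        have h1 := hmul ho (hX1 1)
        have h2 := hmul hz (hX1 0)
        have h3 := mul_nonneg ho (hX 1 1).1
        have h4 := mul_nonneg hz (hX 1 0).1
        exact mono (by linarith) (by linarith) (by linarith)
      linarith
    -- The first two terms of this entry of `B` have equal arguments and cancel.
    rw [show (1 - m) * (1 - q) + m = 1 - (1 - m) * q by ring, sub_self, zero_add, eq0 hXY]
    have e2 := distrib q
    have h1 := hmul ho hle
    have h2 := hmul hz (hY0 0)
    have h3 := hmul ho (hY 0 1).2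
    have h4 := hmul hz (hY 0 0).2
    have h5 := mul_nonneg ho hq.1
    have h6 := mul_nonneg hz hq.1
    have h7 := hmul ho hmon
    exact ⟨mono (by linarith) (by linarith) (by linarith), (hG (by linarith) (by linarith)).2⟩
  rw [hbdef] at hA11 hB01 hB00
  have hX1' (j : Fin 2) : X 1 j ≤ pgf χ (1 - o) := by simpa [hbdef] using hX1 j
  fin_cases i <;> fin_cases j
  · exact ⟨⟨hq.1, hX0 0⟩, hB00⟩
  · exact ⟨⟨hq.1, hX0 1⟩, hB01⟩
  · exact ⟨hA10, hX1' 0, hb.2⟩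
  · exact ⟨hA11, hX1' 1, hb.2⟩

/-! ### Uniqueness of the fixed point -/

lemma rowFun_anti (r : Fin 2) {x y : Fin 2 → ℝ} (hx : ∀ j, x j ∈ Set.Icc (0 : ℝ) 1)
    (hy : ∀ j, y j ∈ Set.Icc (0 : ℝ) 1) (hxy : ∀ j, x j ≤ y j) :
    rowFun χ p r y ≤ rowFun χ p r x :=
  affinePgf_anti (rowCoeff_nonneg p r) (rowCoeff_add_le p r) (rowConst_le_one p r) hx hy hxy

/-- Above the point `w`, the increments of `f1` and `f2` are controlled by the derivative of the
generating function at the affine image of `w`. -/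
lemma abs_rowFun_sub_le (a : Fin 2) {x y w : Fin 2 → ℝ} (hx : ∀ j, x j ∈ Set.Icc (0 : ℝ) 1)
    (hy : ∀ j, y j ∈ Set.Icc (0 : ℝ) 1) (hw : ∀ j, w j ∈ Set.Icc (0 : ℝ) 1)
    (hwx : ∀ j, w j ≤ x j) (hwy : ∀ j, w j ≤ y j)
    (hd : DifferentiableWithinAt ℝ (pgf χ) (Set.Icc 0 1)
      (rowConst p a - rowCoeff p a 1 * w 1 - rowCoeff p a 0 * w 0)) :
    |rowFun χ p a x - rowFun χ p a y| ≤
      pgf' χ (rowConst p a - rowCoeff p a 1 * w 1 - rowCoeff p a 0 * w 0) *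
        (rowCoeff p a 1 * |x 1 - y 1| + rowCoeff p a 0 * |x 0 - y 0|) := by
  have hmem {u : Fin 2 → ℝ} (hu : ∀ j, u j ∈ Set.Icc (0 : ℝ) 1) :=
    affine_mem (rowCoeff_nonneg p a) (rowCoeff_add_le p a) (rowConst_le_one p a) hu
  have hle {u : Fin 2 → ℝ} (hwu : ∀ j, w j ≤ u j) :
      rowConst p a - rowCoeff p a 1 * u 1 - rowCoeff p a 0 * u 0 ≤
        rowConst p a - rowCoeff p a 1 * w 1 - rowCoeff p a 0 * w 0 := by
    have h0 := mul_le_mul_of_nonneg_left (hwu 0) (rowCoeff_nonneg p a 0)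
    have h1 := mul_le_mul_of_nonneg_left (hwu 1) (rowCoeff_nonneg p a 1)
    linarith
  refine (abs_pgf_sub_le χ (hmem hw) (hmem hx).1 (hmem hy).1 (hle hwx) (hle hwy) hd).trans
    (mul_le_mul_of_nonneg_left ?_ (pgf'_nonneg χ _))
  have h : rowConst p a - rowCoeff p a 1 * x 1 - rowCoeff p a 0 * x 0 -
      (rowConst p a - rowCoeff p a 1 * y 1 - rowCoeff p a 0 * y 0) =
      rowCoeff p a 1 * (y 1 - x 1) + rowCoeff p a 0 * (y 0 - x 0) := by ring
  rw [h, abs_sub_comm (x 1), abs_sub_comm (x 0)]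
  refine (abs_add_le _ _).trans_eq ?_
  rw [abs_mul, abs_mul, abs_of_nonneg (rowCoeff_nonneg p a 1),
    abs_of_nonneg (rowCoeff_nonneg p a 0)]

/-- The argument of the outer derivative in the row `a` and the column `b` of `h`. -/
noncomputable def outerArg (χ : PMF ℕ) (p : PMF SignType) (a b : Fin 2) : ℝ :=
  rowConst p a - rowCoeff p a 1 * rowFun χ p b (B χ p 1) - rowCoeff p a 0 * rowFun χ p b (B χ p 0)

lemma differentiableWithinAt_slice_of_eDefined {i j : Fin 2} (hE : EDefined χ p i j) (b : Fin 2) :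
    DifferentiableWithinAt ℝ (slice (rowFun χ p b) (A χ p i) j) (Set.Icc 0 1) (A χ p i j) := by
  fin_cases b
  · exact (hE (f1 χ p) (by simp)).1
  · exact (hE (f2 χ p) (by simp)).1

lemma differentiableWithinAt_outerArg_of_eDefined {i j : Fin 2} (hE : EDefined χ p i j)
    (a b : Fin 2) : DifferentiableWithinAt ℝ (pgf χ) (Set.Icc 0 1) (outerArg χ p a b) := by
  fin_cases b <;> fin_cases a
  · exact (hE (f1 χ p) (by simp)).2.1
  · exact (hE (f1 χ p) (by simp)).2.2
  · exact (hE (f2 χ p) (by simp)).2.1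
  · exact (hE (f2 χ p) (by simp)).2.2

/-- The matrices with entries between `A` and `B`. -/
def Between (χ : PMF ℕ) (p : PMF SignType) (X : Matrix (Fin 2) (Fin 2) ℝ) : Prop :=
  ∀ i j, A χ p i j ≤ X i j ∧ X i j ≤ B χ p i j

/-- The affine arguments decrease in the variables. For the inner functions they are therefore
largest at `A`; for the outer ones they are largest at the inner values at `B`, which are the
smallest since the inner functions are decreasing. -/
lemma abs_halfStep_halfStep_sub_le (hA : ∀ i j, 0 ≤ A χ p i j) (hB : ∀ i j, B χ p i j ≤ 1)
    (hE : ∀ i j, EDefined χ p i j) {X Y : Matrix (Fin 2) (Fin 2) ℝ} (hX : Between χ p X)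
    (hY : Between χ p Y) (a b : Fin 2) :
    |halfStep χ p (halfStep χ p X) a b - halfStep χ p (halfStep χ p Y) a b| ≤
      pgf' χ (outerArg χ p a b) *
        (rowCoeff p a 1 * (-pderiv (rowFun χ p b) 0 (A χ p 1) * |X 1 0 - Y 1 0| +
          -pderiv (rowFun χ p b) 1 (A χ p 1) * |X 1 1 - Y 1 1|) +
        rowCoeff p a 0 * (-pderiv (rowFun χ p b) 0 (A χ p 0) * |X 0 0 - Y 0 0| +
          -pderiv (rowFun χ p b) 1 (A χ p 0) * |X 0 1 - Y 0 1|)) := by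
  have hmem {U : Matrix (Fin 2) (Fin 2) ℝ} (hU : Between χ p U) (i j : Fin 2) :
      U i j ∈ Set.Icc (0 : ℝ) 1 := ⟨(hA i j).trans (hU i j).1, (hU i j).2.trans (hB i j)⟩
  have hBmem (i j : Fin 2) : B χ p i j ∈ Set.Icc (0 : ℝ) 1 :=
    ⟨(hmem hX i j).1.trans (hX i j).2, hB i j⟩
  have hAmem (i j : Fin 2) : A χ p i j ∈ Set.Icc (0 : ℝ) 1 :=
    ⟨hA i j, (hX i j).1.trans (hmem hX i j).2⟩
  have hinner (i : Fin 2) := abs_affinePgf_sub_le (χ := χ) (rowCoeff_nonneg p b)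
    (rowCoeff_add_le p b) (rowConst_le_one p b) (hAmem i)
    (fun j => differentiableWithinAt_slice_of_eDefined (hE i j) b)
    (fun j => ⟨(hX i j).1, (hmem hX i j).2⟩) (fun j => ⟨(hY i j).1, (hmem hY i j).2⟩)
  have houter := abs_rowFun_sub_le (χ := χ) (p := p) a (x := fun c => rowFun χ p b (X c))
    (y := fun c => rowFun χ p b (Y c)) (w := fun c => rowFun χ p b (B χ p c))
    (fun c => rowFun_mem (hmem hX c) b) (fun c => rowFun_mem (hmem hY c) b)
    (fun c => rowFun_mem (hBmem c) b)
    (fun c => rowFun_anti b (hmem hX c) (hBmem c) fun j => (hX c j).2)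
    (fun c => rowFun_anti b (hmem hY c) (hBmem c) fun j => (hY c j).2)
    -- The conditions on the outer derivatives do not involve the indices, so any pair serves.
    (differentiableWithinAt_outerArg_of_eDefined (hE 0 0) a b)
  refine houter.trans (mul_le_mul_of_nonneg_left ?_ (pgf'_nonneg χ _))
  exact add_le_add (mul_le_mul_of_nonneg_left (hinner 1) (rowCoeff_nonneg p a 1))
    (mul_le_mul_of_nonneg_left (hinner 0) (rowCoeff_nonneg p a 0))

/-- The left side is the total coefficient of |X_ij - Y_ij| when the entrywise estimates are added
over all output entries; `E` is the absolute value of its negative. -/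
lemma sum_le_E (i j : Fin 2) :
    ∑ a, ∑ b, pgf' χ (outerArg χ p a b) *
      (rowCoeff p a i * -pderiv (rowFun χ p b) j (A χ p i)) ≤ E χ p i j := by
  refine le_trans (le_of_eq ?_) (neg_le_abs _)
  simp only [Fin.sum_univ_two]
  have h00 : outerArg χ p 0 0 = outerU χ p (f1 χ p) := rfl
  have h01 : outerArg χ p 0 1 = outerU χ p (f2 χ p) := rfl
  have h10 : outerArg χ p 1 0 = outerV χ p (f1 χ p) := rfl
  have h11 : outerArg χ p 1 1 = outerV χ p (f2 χ p) := rfl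
  rw [h00, h01, h10, h11, rowFun_zero, rowFun_one]
  simp only [rowCoeff, Matrix.cons_val_zero, Matrix.cons_val_one]
  ring

theorem eq_of_halfStep_halfStep_eq (hA : ∀ i j, 0 ≤ A χ p i j) (hB : ∀ i j, B χ p i j ≤ 1)
    (hE : ∀ i j, EDefined χ p i j ∧ E χ p i j < 1) {X Y : Matrix (Fin 2) (Fin 2) ℝ}
    (hX : Between χ p X) (hY : Between χ p Y) (hXX : halfStep χ p (halfStep χ p X) = X)
    (hYY : halfStep χ p (halfStep χ p Y) = Y) : X = Y := by
  have hle (a b : Fin 2) :=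
    abs_halfStep_halfStep_sub_le hA hB (fun i j => (hE i j).1) hX hY a b
  rw [hXX, hYY] at hle
  have hsum (i j : Fin 2) := mul_le_mul_of_nonneg_left (sum_le_E (χ := χ) (p := p) i j)
    (abs_nonneg (X i j - Y i j))
  have hpos (i j : Fin 2) : 0 ≤ |X i j - Y i j| * (1 - E χ p i j) :=
    mul_nonneg (abs_nonneg _) (by linarith [(hE i j).2])
  -- For two fixed points the left sides of `hle` are the differences themselves, so the total
  -- distance is bounded by its own `E`-weighted version.
  have htotal : ∑ i, ∑ j, |X i j - Y i j| * (1 - E χ p i j) ≤ 0 := by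
    simp only [Fin.sum_univ_two] at hsum ⊢
    linarith [hle 0 0, hle 0 1, hle 1 0, hle 1 1, hsum 0 0, hsum 0 1, hsum 1 0, hsum 1 1]
  ext i j
  have h0 : |X i j - Y i j| * (1 - E χ p i j) ≤ 0 := by
    refine le_trans ?_ htotal
    refine le_trans ?_ (Finset.single_le_sum (f := fun i => ∑ j, |X i j - Y i j| * (1 - E χ p i j))
      (fun i _ => Finset.sum_nonneg fun j _ => hpos i j) (Finset.mem_univ i))
    exact Finset.single_le_sum (f := fun j => |X i j - Y i j| * (1 - E χ p i j))
      (fun j _ => hpos i j) (Finset.mem_univ j)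
  have h1 : |X i j - Y i j| ≤ 0 := by
    by_contra! h
    exact absurd h0 (not_le.2 (mul_pos h (by linarith [(hE i j).2])))
  exact sub_eq_zero.1 (abs_nonpos_iff.1 h1)

end FixedPoint

/-! ### The outcome probabilities for target capital `3` -/

section Target

variable (χ : PMF ℕ) (p : PMF SignType)

/-- The matrix of the loss probabilities. -/
noncomputable def lossMatrix : Matrix (Fin 2) (Fin 2) ℝ :=
  Matrix.of fun i j => lossProb χ p 3 ((i : ℕ) + 1) ((j : ℕ) + 1)

/-- The matrix of the probabilities not to win. -/
noncomputable def notWinMatrix : Matrix (Fin 2) (Fin 2) ℝ :=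
  Matrix.of fun i j => 1 - winProb χ p 3 ((i : ℕ) + 1) ((j : ℕ) + 1)

lemma lossMatrix_mem : lossMatrix χ p ∈ unitMatrices 2 :=
  fun _ _ => ⟨MeasureTheory.measureReal_nonneg, MeasureTheory.measureReal_le_one⟩

lemma notWinMatrix_mem : notWinMatrix χ p ∈ unitMatrices 2 :=
  fun _ _ => ⟨sub_nonneg.2 MeasureTheory.measureReal_le_one,
    sub_le_self _ MeasureTheory.measureReal_nonneg⟩

lemma undecided_three (i j : Fin 2) : Undecided 3 ((i : ℕ) + 1) ((j : ℕ) + 1) := by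
  fin_cases i <;> fin_cases j <;> simp [Undecided]

/-- Capital 0 after the move makes the opponent win surely, capital 3 makes her win impossible.
These two boundary values produce the constants in `rowConst`. -/
lemma lossMatrix_eq : lossMatrix χ p = halfStep χ p (notWinMatrix χ p) := by
  have hp : pp p = 1 - pm p - pz p := by linarith [sum_toReal_pmf_signType p]
  ext i j
  have hj0 := winProb_broke χ p 3 ((j : ℕ) + 1)
  have hj3 := winProb_target χ p 3 ((j : ℕ) + 1) (undecided_three j j).1.2 three_ne_zero
  have h := lossProb_eq χ p 3 _ _ (undecided_three i j) three_ne_zero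
  refine h.trans ?_
  simp only [Nat.cast_ofNat] at hj3
  fin_cases i <;>
  · simp only [halfStep, rowFun, affinePgf, rowConst, rowCoeff, Matrix.of_apply, notWinMatrix]
    congr 1
    norm_num [hj0, hj3]
    linarith

lemma notWinMatrix_eq : notWinMatrix χ p = halfStep χ p (lossMatrix χ p) := by
  have hp : pp p = 1 - pm p - pz p := by linarith [sum_toReal_pmf_signType p]
  ext i j
  have hj0 := lossProb_broke χ p 3 ((j : ℕ) + 1) (undecided_three j j).1.1 three_ne_zero
  have hj3 := lossProb_target χ p 3 ((j : ℕ) + 1)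
  have h := one_sub_winProb_eq χ p 3 _ _ (undecided_three i j) three_ne_zero
  refine h.trans ?_
  simp only [Nat.cast_ofNat] at hj3
  fin_cases i <;>
  · simp only [halfStep, rowFun, affinePgf, rowConst, rowCoeff, Matrix.of_apply, lossMatrix]
    congr 1
    norm_num [hj0, hj3]
    linarith

end Target

end CapitalGame

theorem theorem5 (χ : PMF ℕ) (hχ : χ 0 < 1) (p : PMF SignType) :
    (∀ i j : Fin 2,
      CapitalGame.A χ p i j ≤ CapitalGame.lossProb χ p 3 ((i : ℕ) + 1) ((j : ℕ) + 1) ∧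
      1 - CapitalGame.winProb χ p 3 ((i : ℕ) + 1) ((j : ℕ) + 1) ≤ CapitalGame.B χ p i j) ∧
    ((∀ i j : Fin 2, CapitalGame.EDefined χ p i j ∧ CapitalGame.E χ p i j < 1) →
      (∃! X : Matrix (Fin 2) (Fin 2) ℝ,
        X ∈ CapitalGame.unitMatrices 2 ∧ CapitalGame.h χ p 2 X = X) ∧
      ∀ i j : Fin 2, CapitalGame.drawProb χ p 3 ((i : ℕ) + 1) ((j : ℕ) + 1) = 0) := by
  open CapitalGame in
  have hL := bounds_of_halfStep (lossMatrix_mem χ p) (notWinMatrix_mem χ p) (lossMatrix_eq χ p)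
    (notWinMatrix_eq χ p)
  have hU := bounds_of_halfStep (notWinMatrix_mem χ p) (lossMatrix_mem χ p) (notWinMatrix_eq χ p)
    (lossMatrix_eq χ p)
  refine ⟨fun i j => ⟨(hL i j).1.2, (hU i j).2.1⟩, fun hE => ?_⟩
  have hunique {X Y : Matrix (Fin 2) (Fin 2) ℝ} (hX : X ∈ unitMatrices 2)
      (hY : Y ∈ unitMatrices 2) (hXX : h χ p 2 X = X) (hYY : h χ p 2 Y = Y) : X = Y := by
    rw [h_eq_halfStep_halfStep] at hXX hYY
    -- An arbitrary fixed point has no game interpretation, but it is exchanged with its own image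
    -- under `halfStep`, and the bounds use nothing more.
    have hXb := bounds_of_halfStep hX (halfStep_mem hX) hXX.symm rfl
    have hYb := bounds_of_halfStep hY (halfStep_mem hY) hYY.symm rfl
    exact eq_of_halfStep_halfStep_eq (fun i j => (hL i j).1.1) (fun i j => (hL i j).2.2) hE
      (fun i j => ⟨(hXb i j).1.2, (hXb i j).2.1⟩) (fun i j => ⟨(hYb i j).1.2, (hYb i j).2.1⟩)
      hXX hYY
  have hLfix : h χ p 2 (lossMatrix χ p) = lossMatrix χ p := by
    rw [h_eq_halfStep_halfStep, ← notWinMatrix_eq, ← lossMatrix_eq]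
  have hUfix : h χ p 2 (notWinMatrix χ p) = notWinMatrix χ p := by
    rw [h_eq_halfStep_halfStep, ← lossMatrix_eq, ← notWinMatrix_eq]
  refine ⟨⟨_, ⟨lossMatrix_mem χ p, hLfix⟩, fun Y hY =>
    hunique hY.1 (lossMatrix_mem χ p) hY.2 hLfix⟩, fun i j => ?_⟩
  have hLU := congrFun (congrFun
    (hunique (lossMatrix_mem χ p) (notWinMatrix_mem χ p) hLfix hUfix) i) j
  rw [drawProb_eq χ p 3 _ _ (undecided_three i j).1.1 (undecided_three i j).1.2 three_ne_zero]
  exact sub_eq_zero.2 hLU.symm
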